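/- **Setting.** Let $\{L_\gamma\}_{\gamma\in\Gamma}$ be scale invariant losses on $\mathbb R^d\setminus\{0\}$ (that is, $L_\gamma(cx)=L_\gamma(x)$ for all $c>0$, $x\neq 0$), differentiable on $\mathbb R^d\setminus\{0\}$, and let $\gamma_0,\gamma_1,\dots$ be i.i.d. $\Gamma$-valued random variables. Let $\eta,\lambda>0$, $C>1$, $x(0)\ne 0$, and let $x(t)$ be the iterates of $\sqrt C$-clipped SGD with weight decay: $$x(t+1)=(1-\eta\lambda)x(t)-\eta N_t\frac{\nabla L_{\gamma_t}(x(t))}{\|\nabla L_{\gamma_t}(x(t))\|_2},\qquad N_t=\min\Big\{\sqrt{\tfrac{2C\lambda}{\eta}}\,\|x(t)\|_2,\ \|\nabla L_{\gamma_t}(x(t))\|_2\Big\}$$ (the gradient term is $0$ if $\nabla L_{\gamma_t}(x(t))=0$). Put $R_t=\sqrt{2\lambda/\eta}\,\|x(t)\|_2^2$, so that $R_t^2=\frac{2\lambda}{\eta}\|x(t)\|_2^4$. For a probability distribution $P$ on $[0,\infty)$ let the $C$-clipped mean $\mu_{P,C}$ be the largest $\mu\ge 0$ with $\mathbb E_{t\sim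 P}[\min\{t,C\mu\}]=\mu$, and let $M_{P,1/C}=\sup\{M\ge 0:\ \mathbb P_{t\sim P}[t\ge M]\ge 1/C\}$. Let $P_x$ be the law of $\|\nabla L_\gamma(x)\|_2^2$, and let $\mu_{\min}=\min_{\|x\|_2=1}\mu_{P_x,C}$ and $\mu_{\max}=\max_{\|x\|_2=1}\mu_{P_x,C}$ (assumed to exist, with $\mu_{\min}>0$). **Assumption.** $\alpha_C>0$ is such that for all $x\neq0$, $\ \alpha_C\,\mu_{P_x,C}\le \mathbb E_{t\sim P_x}\big[t\,\mathbf 1[t<M_{P_x,1/C}]\big]$. **Theorem.** There are absolute constants $c,K_1,K_2>0$ such that the following holds for every such setting, every integer $T\ge1$ and every $\delta\in(0,1)$. Suppose the assumption holds and $$\eta\lambda\le c\,\min\Big\{1,\ \frac{\alpha_C}{C\ln (T/\delta^2)}\Big\}.$$ Put $$T'=\frac{\max\big\{\ln\frac{R_0^2}{\mu_{\max}},\ \ln\frac{\mu_{\min}}{R_0^2}\big\}+K_1}{\alpha_C\,\eta\lambda},\qquad \epsilon=K_2\sqrt{\tfrac{C}{\alpha_C}\ln\tfrac{T}{\delta^2}}\,\sqrt{\eta\lambda},$$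 $$\beta_l=1-2\lambda^2\eta^2+\eta^4\lambda^4-4\eta\lambda\alpha_C(1-\eta\lambda)^2,\qquad \beta_u=\beta_l+4C^2\eta^2\lambda^2.$$ Then, with probability at least $1-3\delta$, for all integers $t\ge 0$ with $T'\le t\le T$, $$\frac{\mu_{\min}}2\le R_t^2\le 2\mu_{\max},$$ and more precisely $$(1-\beta_l^{\,t-T'})\mu_{\min}-\epsilon\,\mu_{\min}\ \le\ R_t^2\ \le\ \mu_{\max}(1+\beta_u^{\,t-T'})+\epsilon\,\mu_{\max}.$$ -/

import Mathlib

open MeasureTheory ProbabilityTheory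

noncomputable section

namespace ClippedSGD

/-- `f`, viewed as a function on `ℝ^d ∖ {0}`, is scale invariant (positively `0`-homogeneous). -/
def ScaleInvariant {d : ℕ} (f : EuclideanSpace ℝ (Fin d) → ℝ) : Prop :=
  ∀ c : ℝ, 0 < c → ∀ x, x ≠ 0 → f (c • x) = f x

/-- One step of `√C`-clipped SGD with learning rate `η` and weight decay `lam` on the loss `f`:
`x ↦ (1 - η lam) x - η N ∇f(x)/‖∇f(x)‖`, where `N = min {√(2 C lam / η) ‖x‖, ‖∇f(x)‖}`.
(If `∇f(x) = 0` then `N = 0` and the gradient term vanishes.) -/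
def clippedStep {d : ℕ} (C η lam : ℝ) (f : EuclideanSpace ℝ (Fin d) → ℝ)
    (x : EuclideanSpace ℝ (Fin d)) : EuclideanSpace ℝ (Fin d) :=
  (1 - η * lam) • x -
    (η * min (Real.sqrt (2 * C * lam / η) * ‖x‖) ‖gradient f x‖) •
      (‖gradient f x‖⁻¹ • gradient f x)

/-- The iterates of `√C`-clipped SGD with weight decay, started at `x₀`, where the loss used in
step `t` is `ℓ t`. -/
def iterate {d : ℕ} (C η lam : ℝ) (x₀ : EuclideanSpace ℝ (Fin d))
    (ℓ : ℕ → EuclideanSpace ℝ (Fin d) → ℝ) : ℕ → EuclideanSpace ℝ (Fin d)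
  | 0 => x₀
  | t + 1 => clippedStep C η lam (ℓ t) (iterate C η lam x₀ ℓ t)

/-- The rescaled squared norm `R = √(2 lam / η) ‖x‖²`, so that `R² = (2 lam / η) ‖x‖⁴`. -/
def scaledNorm {d : ℕ} (η lam : ℝ) (x : EuclideanSpace ℝ (Fin d)) : ℝ :=
  Real.sqrt (2 * lam / η) * ‖x‖ ^ 2

/-- The truncated mean `E_{t ∼ P} min {t, m}`. -/
def truncMean (P : Measure ℝ) (m : ℝ) : ℝ := ∫ t, min t m ∂P

/-- The `C`-clipped mean of a distribution `P` on `[0, ∞)`: the largest `m ≥ 0` with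
`E_{t ∼ P} min {t, C m} = m`. It is attained, see `isGreatest_clippedMean`. -/
def clippedMean (P : Measure ℝ) (C : ℝ) : ℝ :=
  sSup {m : ℝ | 0 ≤ m ∧ truncMean P (C * m) = m}

/-- The `1/C`-median of `P`: `sup {M ≥ 0 | P[t ≥ M] ≥ 1/C}`. -/
def upperMedian (P : Measure ℝ) (C : ℝ) : ℝ :=
  sSup {M : ℝ | 0 ≤ M ∧ 1 / C ≤ P.real {t | M ≤ t}}

/-- The law `P_x` of `‖∇L_γ(x)‖²` when `γ` has law `D`. -/
def gradSqLaw {d : ℕ} {Γ : Type*} [MeasurableSpace Γ] (D : Measure Γ)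
    (L : Γ → EuclideanSpace ℝ (Fin d) → ℝ) (x : EuclideanSpace ℝ (Fin d)) : Measure ℝ :=
  D.map (fun γ => ‖gradient (L γ) x‖ ^ 2)

/-- The values of the clipped mean `μ_{P_x, C}` on the unit sphere. -/
def sphereClippedMeans {d : ℕ} {Γ : Type*} [MeasurableSpace Γ] (D : Measure Γ)
    (L : Γ → EuclideanSpace ℝ (Fin d) → ℝ) (C : ℝ) : Set ℝ :=
  (fun x => clippedMean (gradSqLaw D L x) C) '' {x | ‖x‖ = 1}

/-- The concentration assumption with constant `α`: for all `x ≠ 0`, the clipped mean satisfies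
`α μ_{P_x, C} ≤ E_{t ∼ P_x} [t 1[t < M]]`, where `M` is the `1/C`-median of `P_x`. -/
def Concentrated {d : ℕ} {Γ : Type*} [MeasurableSpace Γ] (D : Measure Γ)
    (L : Γ → EuclideanSpace ℝ (Fin d) → ℝ) (C α : ℝ) : Prop :=
  ∀ x, x ≠ 0 →
    α * clippedMean (gradSqLaw D L x) C ≤
      ∫ t, (Set.Iio (upperMedian (gradSqLaw D L x) C)).indicator (fun t => t) t
        ∂(gradSqLaw D L x)

/-- The contraction factor of the lower bound. -/
def betaL (η lam α : ℝ) : ℝ :=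
  1 - 2 * lam ^ 2 * η ^ 2 + η ^ 4 * lam ^ 4 - 4 * η * lam * α * (1 - η * lam) ^ 2

/-- The contraction factor of the upper bound. -/
def betaU (C η lam α : ℝ) : ℝ :=
  1 - 2 * lam ^ 2 * η ^ 2 + η ^ 4 * lam ^ 4 - 4 * η * lam * α * (1 - η * lam) ^ 2
    + 4 * C ^ 2 * η ^ 2 * lam ^ 2

/-- The supremum defining the clipped mean is a maximum. -/
theorem isGreatest_clippedMean (P : Measure ℝ) [IsProbabilityMeasure P]
    (hP : ∀ᵐ t ∂P, 0 ≤ t) (C : ℝ) (hC : 1 < C) :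
    IsGreatest {m : ℝ | 0 ≤ m ∧ truncMean P (C * m) = m} (clippedMean P C) := by
  have hmeas : ∀ m : ℝ, AEStronglyMeasurable (fun t : ℝ => min t m) P := fun m =>
    (measurable_id.min measurable_const).aestronglyMeasurable
  have hbound : ∀ m : ℝ, ∀ᵐ t ∂P, ‖min t m‖ ≤ |m| := fun m => by
    filter_upwards [hP] with t ht
    rw [Real.norm_eq_abs]
    rcases le_total t m with h | h
    · rw [min_eq_left h, abs_of_nonneg ht]; exact h.trans (le_abs_self m)
    · rw [min_eq_right h]
  have hint : ∀ m : ℝ, Integrable (fun t : ℝ => min t m) P := fun m =>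
    Integrable.of_bound (hmeas m) |m| (hbound m)
  have hlip : ∀ m m' : ℝ, |truncMean P m - truncMean P m'| ≤ |m - m'| := fun m m' => by
    unfold truncMean
    rw [← integral_sub (hint m) (hint m')]
    have := norm_integral_le_of_norm_le_const (μ := P) (C := |m - m'|)
      (f := fun t => min t m - min t m') (Filter.Eventually.of_forall fun t => by
        rw [Real.norm_eq_abs]
        have := abs_min_sub_min_le_max t m t m'
        simpa using this)
    simpa using this
  have hcont : Continuous (truncMean P) := by
    refine LipschitzWith.continuous (K := 1) (LipschitzWith.of_dist_le_mul fun m m' => ?_)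
    simpa [Real.dist_eq] using hlip m m'
  have hclosed : IsClosed {m : ℝ | 0 ≤ m ∧ truncMean P (C * m) = m} :=
    (isClosed_le continuous_const continuous_id).inter
      (isClosed_eq (hcont.comp (continuous_const.mul continuous_id)) continuous_id)
  have hne : (0 : ℝ) ∈ {m : ℝ | 0 ≤ m ∧ truncMean P (C * m) = m} := by
    refine ⟨le_rfl, ?_⟩
    unfold truncMean
    rw [integral_congr_ae (g := fun _ => (0 : ℝ))]
    · simp
    · filter_upwards [hP] with t ht
      simpa using ht
  have hlim : Filter.Tendsto (fun m : ℝ => ∫ t, min t (C * m) / m ∂P) Filter.atTop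
      (nhds (∫ _t, (0 : ℝ) ∂P)) := by
    refine tendsto_integral_filter_of_dominated_convergence (fun _ => C) ?_ ?_
      (integrable_const C) ?_
    · exact Filter.Eventually.of_forall fun m =>
        ((measurable_id.min measurable_const).div_const m).aestronglyMeasurable
    · filter_upwards [Filter.eventually_gt_atTop 0] with m hm
      filter_upwards [hbound (C * m)] with t ht
      rw [norm_div, Real.norm_eq_abs m, abs_of_pos hm, div_le_iff₀ hm]
      rwa [abs_of_pos (mul_pos (by linarith) hm)] at ht
    · filter_upwards [hP] with t ht
      refine squeeze_zero' (g := fun m => t / m) ?_ ?_ (tendsto_const_nhds.div_atTop Filter.tendsto_id)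
      · filter_upwards [Filter.eventually_gt_atTop 0] with m hm
        exact div_nonneg (le_min ht (mul_pos (by linarith) hm).le) hm.le
      · filter_upwards [Filter.eventually_gt_atTop 0] with m hm
        exact div_le_div_of_nonneg_right (min_le_left _ _) hm.le
  have hbdd : BddAbove {m : ℝ | 0 ≤ m ∧ truncMean P (C * m) = m} := by
    simp only [integral_zero] at hlim
    obtain ⟨B, hB⟩ := Filter.eventually_atTop.1
      ((hlim.eventually (gt_mem_nhds one_pos)).and (Filter.eventually_gt_atTop 0))
    refine ⟨B, fun m hm => ?_⟩
    by_contra hlt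
    obtain ⟨h1, h2⟩ := hB m (not_le.1 hlt).le
    rw [integral_div, div_lt_one h2] at h1
    exact h1.ne hm.2
  exact ⟨hclosed.csSup_mem ⟨0, hne⟩ hbdd, fun m hm => le_csSup hbdd hm⟩

end ClippedSGD

end

/-! ### Truncated means and the `1/C`-median -/

namespace ClippedSGD

/-! Write h = ηλ and F(m) = E min {t, m}. Scale invariance makes the gradient orthogonal to x and
homogeneous of degree -1. Hence y = R²/μ, with μ either `μmax` or `μmin`, obeys a scalar recursion
y' = y((1 - h)² + 2hm)², where m ∈ [0, C] is the clipped ratio and R² E[m | x] = F(C R²) for the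
gradient law at x/‖x‖ (`scaledNorm_clippedStep`, `scaledNorm_mul_integral_clippedRatio`).

The drift is therefore governed by G(s) = F(Cs) - s, a concave function vanishing at 0 and at the
clipped mean. The concentration assumption bounds G from below at the single point s = M/C, M being
the `1/C`-median, by α times the clipped mean. Concavity spreads this to a linear restoring drift of
rate α on both sides of the clipped mean (`truncMean_drift`). Since (1 - h)⁴ + 4h(1 - h)² = (1 -
h²)², the mean of y - 1 then contracts by exactly β_l, up to errors of order h²C.

Concentration uses exponential moments only. Far from equilibrium, y^k (or y^(-k)) with k of order
α/(hC) is a Lyapunov function; Markov's inequality at each time after a logarithmic entrance time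
shows that leaving a fixed window (y ≤ 9, respectively y ≥ 1/2) is exponentially unlikely. Inside
the window, the exponential moment of the excess W at parameter θ is controlled by the one at βθ,
and iterating gives a sub-Gaussian bound with variance of order hC/α (`IsChain.truncExp_le`).
Truncating the moments to the window at every time replaces stopping times. Chernoff's bound and a
union bound over times finish each side (`IsChain.uniform_tail_le`).

Both tails decay with β_l; the stated upper bound follows because β_l ≤ β_u. -/

lemma integrable_min_const {P : Measure ℝ} [IsProbabilityMeasure P]
    (hP : ∀ᵐ t ∂P, 0 ≤ t) (m : ℝ) : Integrable (fun t : ℝ => min t m) P := by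
  refine Integrable.of_bound (measurable_id.min measurable_const).aestronglyMeasurable |m| ?_
  filter_upwards [hP] with t ht
  rw [Real.norm_eq_abs]
  rcases le_total t m with h | h
  · rw [min_eq_left h, abs_of_nonneg ht]; exact h.trans (le_abs_self m)
  · rw [min_eq_right h]

lemma truncMean_mono {P : Measure ℝ} [IsProbabilityMeasure P] (hP : ∀ᵐ t ∂P, 0 ≤ t) :
    Monotone (truncMean P) := fun a b hab =>
  integral_mono (integrable_min_const hP a) (integrable_min_const hP b)
    fun _ => min_le_min le_rfl hab

lemma concaveOn_truncMean {P : Measure ℝ} [IsProbabilityMeasure P] (hP : ∀ᵐ t ∂P, 0 ≤ t) :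
    ConcaveOn ℝ Set.univ (truncMean P) := by
  refine ⟨convex_univ, fun x _ y _ a b ha hb hab => ?_⟩
  simp only [smul_eq_mul, truncMean]
  rw [← integral_const_mul, ← integral_const_mul,
    ← integral_add ((integrable_min_const hP x).const_mul a)
      ((integrable_min_const hP y).const_mul b)]
  refine integral_mono (((integrable_min_const hP x).const_mul a).add
      ((integrable_min_const hP y).const_mul b)) (integrable_min_const hP _) fun t => ?_
  refine le_min ?_ ?_
  · have h1 := mul_le_mul_of_nonneg_left (min_le_left t x) ha
    have h2 := mul_le_mul_of_nonneg_left (min_le_left t y) hb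
    have h3 : a * t + b * t = t := by rw [← add_mul, hab, one_mul]
    simp only
    linarith
  · have h1 := mul_le_mul_of_nonneg_left (min_le_right t x) ha
    have h2 := mul_le_mul_of_nonneg_left (min_le_right t y) hb
    simp only
    linarith

lemma truncMean_zero {P : Measure ℝ} (hP : ∀ᵐ t ∂P, 0 ≤ t) : truncMean P 0 = 0 := by
  unfold truncMean
  rw [integral_congr_ae (g := fun _ => (0 : ℝ))]
  · simp
  · filter_upwards [hP] with t ht
    simpa using ht

/-- The supremum is finite because tails vanish, and it is attained because M ↦ P[t ≥ M] is left
continuous: the half-lines along a sequence increasing to the supremum decrease to the half-line at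
the supremum. -/
lemma upperMedian_spec {P : Measure ℝ} [IsProbabilityMeasure P] (hP : ∀ᵐ t ∂P, 0 ≤ t)
    {C : ℝ} (hC : 1 < C) :
    0 ≤ upperMedian P C ∧ 1 / C ≤ P.real {t | upperMedian P C ≤ t} := by
  have hC0 : 0 < C := by linarith
  set A : Set ℝ := {M : ℝ | 0 ≤ M ∧ 1 / C ≤ P.real {t | M ≤ t}} with hA
  have hne : (0 : ℝ) ∈ A := by
    refine ⟨le_rfl, ?_⟩
    have h1 : P {t : ℝ | 0 ≤ t} = 1 := prob_compl_eq_zero_iff (measurableSet_Ici) |>.1 hP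
    rw [measureReal_def, h1]
    simpa using (inv_le_one_of_one_le₀ hC.le)
  have htend : Filter.Tendsto (fun n : ℕ => P.real {t : ℝ | (n : ℝ) ≤ t}) Filter.atTop
      (nhds 0) := by
    have := tendsto_measure_iInter_atTop (μ := P) (s := fun n : ℕ => {t : ℝ | (n : ℝ) ≤ t})
      (fun n => measurableSet_Ici.nullMeasurableSet)
      (fun n m hnm => Set.Ici_subset_Ici.2 (by exact_mod_cast hnm)) ⟨0, measure_ne_top _ _⟩
    have hempty : (⋂ n : ℕ, {t : ℝ | (n : ℝ) ≤ t}) = ∅ := by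
      ext t
      simp only [Set.mem_iInter, Set.mem_ofPred_eq, Set.mem_empty_iff_false, iff_false, not_forall,
        not_le]
      exact exists_nat_gt t
    rw [hempty, measure_empty] at this
    exact (ENNReal.tendsto_toReal ENNReal.zero_ne_top).comp this
  have hbdd : BddAbove A := by
    obtain ⟨n, hn⟩ := (htend.eventually (gt_mem_nhds (show (0 : ℝ) < 1 / C by positivity))).exists
    refine ⟨n, fun M hM => ?_⟩
    by_contra hlt
    have : P.real {t : ℝ | M ≤ t} ≤ P.real {t : ℝ | (n : ℝ) ≤ t} :=
      measureReal_mono fun t ht => (not_le.1 hlt).le.trans ht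
    linarith [hM.2]
  have hsup : IsLUB A (upperMedian P C) := isLUB_csSup ⟨0, hne⟩ hbdd
  refine ⟨hsup.1 hne, ?_⟩
  obtain ⟨u, humono, hule, hut, huA⟩ := hsup.exists_seq_monotone_tendsto ⟨0, hne⟩
  have hlim := tendsto_measure_iInter_atTop (μ := P) (s := fun n : ℕ => {t : ℝ | u n ≤ t})
      (fun n => measurableSet_Ici.nullMeasurableSet)
      (fun n m hnm t ht => le_trans (humono hnm) ht) ⟨0, measure_ne_top _ _⟩
  have heq : (⋂ n : ℕ, {t : ℝ | u n ≤ t}) = {t | upperMedian P C ≤ t} := by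
    ext t
    simp only [Set.mem_iInter, Set.mem_ofPred_eq]
    exact ⟨fun h => le_of_tendsto' hut h, fun h n => (hule n).trans h⟩
  rw [heq] at hlim
  have hlim' : Filter.Tendsto (fun n => P.real {t : ℝ | u n ≤ t}) Filter.atTop
      (nhds (P.real {t | upperMedian P C ≤ t})) :=
    (ENNReal.tendsto_toReal (measure_ne_top _ _)).comp hlim
  exact ge_of_tendsto' hlim' fun n => (huA n).2

/-- The drift `F (C s) - s` at the median is at least the truncated expectation below it. -/
lemma integral_indicator_le_truncMean {P : Measure ℝ} [IsProbabilityMeasure P]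
    (hP : ∀ᵐ t ∂P, 0 ≤ t) {C : ℝ} (hC : 1 < C) :
    ∫ t, (Set.Iio (upperMedian P C)).indicator (fun t => t) t ∂P ≤
      truncMean P (upperMedian P C) - upperMedian P C / C := by
  obtain ⟨h0, h1⟩ := upperMedian_spec hP hC
  set M := upperMedian P C
  have hint : Integrable ((Set.Ici M).indicator (fun _ : ℝ => M)) P :=
    (integrable_const M).indicator measurableSet_Ici
  have hI : ∫ t, (Set.Ici M).indicator (fun _ : ℝ => M) t ∂P = M * P.real {t | M ≤ t} := by
    rw [integral_indicator_const _ measurableSet_Ici, smul_eq_mul, mul_comm]; rfl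
  -- The subtracted term has mean M P[t ≥ M], which is at least M/C by the choice of the median.
  have heq : ∀ t, (Set.Iio M).indicator (fun t => t) t =
      min t M - (Set.Ici M).indicator (fun _ : ℝ => M) t := fun t => by
    rcases lt_or_ge t M with h | h
    · simp [Set.indicator, h, h.le, not_le.2 h]
    · simp [Set.indicator, h, not_lt.2 h]
  simp_rw [heq]
  rw [integral_sub (integrable_min_const hP M) hint, hI]
  have := mul_le_mul_of_nonneg_left h1 h0
  unfold truncMean
  have h3 : M * (1 / C) = M / C := by ring
  linarith

/-! ### Restoring drift from concavity -/

section Drift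

variable {P : Measure ℝ} [IsProbabilityMeasure P] {C α : ℝ}

/-- Drift estimates for the truncated mean around the clipped mean. -/
lemma truncMean_drift (hP : ∀ᵐ t ∂P, 0 ≤ t) (hC : 1 < C) (hα : 0 < α)
    (hμ : 0 < clippedMean P C)
    (hconc : α * clippedMean P C ≤
      ∫ t, (Set.Iio (upperMedian P C)).indicator (fun t => t) t ∂P) :
    α ≤ 1 ∧
    (∀ s, clippedMean P C ≤ s → truncMean P (C * s) ≤ s - α * (s - clippedMean P C)) ∧
    (∀ s, 0 ≤ s → s ≤ clippedMean P C →
      s + α * min (clippedMean P C - s) s ≤ truncMean P (C * s)) := by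
  have hC0 : 0 < C := by linarith
  have hfix : truncMean P (C * clippedMean P C) = clippedMean P C :=
    (isGreatest_clippedMean P hP C hC).1.2
  set μ := clippedMean P C
  obtain ⟨hM0, -⟩ := upperMedian_spec hP hC
  have hG := hconc.trans (integral_indicator_le_truncMean hP hC)
  set M := upperMedian P C
  -- With G(s) = F(Cs) - s, the assumption reads G(s₀) ≥ αμ at this point.
  obtain ⟨s₀, hs₀⟩ : ∃ s₀, s₀ = M / C := ⟨_, rfl⟩
  have hMs : M = C * s₀ := by rw [hs₀]; field_simp
  rw [← hs₀, hMs] at hG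
  have hs₀0 : 0 ≤ s₀ := by rw [hs₀]; positivity
  -- concavity in interpolation form
  have hcc : ∀ x y z, x ≤ y → y ≤ z →
      (z - y) * (truncMean P (C * x) - x) + (y - x) * (truncMean P (C * z) - z) ≤
        (z - x) * (truncMean P (C * y) - y) := by
    intro x y z hxy hyz
    rcases hxy.eq_or_lt with rfl | hxy'
    · simp
    have hzx : 0 < z - x := by linarith
    have := (concaveOn_truncMean hP).2 (Set.mem_univ (C * x)) (Set.mem_univ (C * z))
      (div_nonneg (by linarith) hzx.le : 0 ≤ (z - y) / (z - x))
      (div_nonneg (by linarith) hzx.le : 0 ≤ (y - x) / (z - x)) (by field_simp; ring)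
    simp only [smul_eq_mul] at this
    have h2 : (z - y) / (z - x) * (C * x) + (y - x) / (z - x) * (C * z) = C * y := by
      field_simp; ring
    rw [h2] at this
    have h3 := mul_le_mul_of_nonneg_left this hzx.le
    have h4 : (z - x) * ((z - y) / (z - x) * truncMean P (C * x) +
        (y - x) / (z - x) * truncMean P (C * z)) =
        (z - y) * truncMean P (C * x) + (y - x) * truncMean P (C * z) := by
      field_simp
    rw [h4] at h3
    nlinarith
  have hF0 : truncMean P (C * 0) - 0 = 0 := by rw [mul_zero, truncMean_zero hP, sub_zero]
  have hαμ : 0 < α * μ := mul_pos hα hμ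
  have hpos : 0 < truncMean P (C * s₀) - s₀ := lt_of_lt_of_le hαμ hG
  -- Otherwise μ lies between 0, where G vanishes, and s₀, where G is positive; concavity would
  -- force G(μ) > 0.
  have hs₀μ : s₀ < μ := by
    by_contra hle
    push Not at hle
    have := hcc 0 μ s₀ hμ.le hle
    rw [hF0, hfix] at this
    nlinarith [mul_pos hμ hpos]
  have hs₀pos : 0 < s₀ := by
    rcases hs₀0.eq_or_lt with h | h
    · rw [← h] at hpos; rw [hF0] at hpos; exact absurd hpos (lt_irrefl _)
    · exact h
  refine ⟨?_, fun s hs => ?_, fun s hs0 hs => ?_⟩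
  · have := truncMean_mono hP (mul_le_mul_of_nonneg_left hs₀μ.le hC0.le)
    rw [hfix] at this
    by_contra hlt
    push Not at hlt
    nlinarith
  -- Beyond μ the graph of G lies below the line through s₀ and μ, whose slope is at most -αμ/(μ -
  -- s₀) ≤ -α.
  · have := hcc s₀ μ s hs₀μ.le hs
    rw [hfix, sub_self, mul_zero] at this
    have h1 := mul_le_mul_of_nonneg_left hG (sub_nonneg.2 hs)
    have h2 : (μ - s₀) * (truncMean P (C * s) - s) ≤ (μ - s₀) * (-(α * (s - μ))) := by
      have : (μ - s₀) * (α * (s - μ)) ≤ μ * (α * (s - μ)) :=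
        mul_le_mul_of_nonneg_right (by linarith) (mul_nonneg hα.le (by linarith))
      nlinarith
    have := le_of_mul_le_mul_left h2 (by linarith)
    linarith
  -- Below μ the graph lies above two chords: the one from s₀ to μ gives the bound α(μ - s), the one
  -- from 0 to s₀ gives αs.
  · rcases le_total s₀ s with h | h
    · have h0 := hcc s₀ s μ h hs
      rw [hfix, sub_self, mul_zero, add_zero] at h0
      have h1 := mul_le_mul_of_nonneg_left hG (sub_nonneg.2 hs)
      have h2 : (μ - s₀) * (α * (μ - s)) ≤ (μ - s₀) * (truncMean P (C * s) - s) := by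
        have : (μ - s₀) * (α * (μ - s)) ≤ μ * (α * (μ - s)) :=
          mul_le_mul_of_nonneg_right (by linarith) (mul_nonneg hα.le (by linarith))
        nlinarith
      have := le_of_mul_le_mul_left h2 (by linarith)
      have := mul_le_mul_of_nonneg_left (min_le_left (μ - s) s) hα.le
      linarith
    · have h0 := hcc 0 s s₀ hs0 h
      rw [hF0, mul_zero, zero_add, sub_zero, sub_zero] at h0
      have h1 := mul_le_mul_of_nonneg_left hG hs0
      have h2 : s₀ * (α * s) ≤ s₀ * (truncMean P (C * s) - s) := by
        have : s₀ * (α * s) ≤ μ * (α * s) :=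
          mul_le_mul_of_nonneg_right hs₀μ.le (mul_nonneg hα.le hs0)
        nlinarith
      have := le_of_mul_le_mul_left h2 hs₀pos
      have := mul_le_mul_of_nonneg_left (min_le_right (μ - s) s) hα.le
      linarith

/-- Drift bounds relative to an upper bound of the clipped mean. -/
lemma truncMean_le_of_clippedMean_le (hP : ∀ᵐ t ∂P, 0 ≤ t) (hC : 1 < C) (hα : 0 < α)
    (hμ : 0 < clippedMean P C)
    (hconc : α * clippedMean P C ≤
      ∫ t, (Set.Iio (upperMedian P C)).indicator (fun t => t) t ∂P)
    {b s : ℝ} (hb : clippedMean P C ≤ b) :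
    (b ≤ s → truncMean P (C * s) ≤ s - α * (s - b)) ∧ (s ≤ b → truncMean P (C * s) ≤ b) := by
  obtain ⟨-, hup, -⟩ := truncMean_drift hP hC hα hμ hconc
  refine ⟨fun h => ?_, fun h => ?_⟩
  · nlinarith [hup s (hb.trans h)]
  · rcases le_total s (clippedMean P C) with h' | h'
    · have := truncMean_mono hP (mul_le_mul_of_nonneg_left h' (by linarith : (0 : ℝ) ≤ C))
      rw [(isGreatest_clippedMean P hP C hC).1.2] at this
      linarith
    · nlinarith [hup s h']

/-- Drift bounds relative to a lower bound of the clipped mean. -/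
lemma le_truncMean_of_le_clippedMean (hP : ∀ᵐ t ∂P, 0 ≤ t) (hC : 1 < C) (hα : 0 < α)
    (hμ : 0 < clippedMean P C)
    (hconc : α * clippedMean P C ≤
      ∫ t, (Set.Iio (upperMedian P C)).indicator (fun t => t) t ∂P)
    {b s : ℝ} (hb : b ≤ clippedMean P C) (hs : 0 ≤ s) :
    (s ≤ b → s + α * min (b - s) s ≤ truncMean P (C * s)) ∧
      (b ≤ s → b ≤ truncMean P (C * s)) := by
  obtain ⟨-, -, hlow⟩ := truncMean_drift hP hC hα hμ hconc
  refine ⟨fun h => ?_, fun h => ?_⟩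
  · have h1 := hlow s hs (h.trans hb)
    have h2 : min (b - s) s ≤ min (clippedMean P C - s) s := min_le_min (by linarith) le_rfl
    nlinarith
  · rcases le_total s (clippedMean P C) with h' | h'
    · have h1 := hlow s hs h'
      have : 0 ≤ min (clippedMean P C - s) s := le_min (by linarith) hs
      nlinarith
    · have := truncMean_mono hP (mul_le_mul_of_nonneg_left h' (by linarith : (0 : ℝ) ≤ C))
      rw [(isGreatest_clippedMean P hP C hC).1.2] at this
      linarith

end Drift

/-! ### Chains driven by independent noise: Lyapunov and exponential moments -/

section Chain

variable {E Γ Ω : Type*} [MeasurableSpace E] [MeasurableSpace Γ] [MeasurableSpace Ω]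
  {D : Measure Γ} {P : Measure Ω} [IsProbabilityMeasure P] {γ : ℕ → Ω → Γ}
  {step : E → Γ → E} {X : ℕ → Ω → E} {x₀ : E}

omit [MeasurableSpace Ω] in
/-- The states of a chain driven by `γ` depend measurably on the past of `γ`. -/
lemma chain_measurable_past (hstep : Measurable (Function.uncurry step))
    (hX0 : ∀ ω, X 0 ω = x₀) (hX : ∀ t ω, X (t + 1) ω = step (X t ω) (γ t ω)) (t : ℕ) :
    Measurable[⨆ i ∈ Set.Iio t, MeasurableSpace.comap (γ i) inferInstance] (X t) := by
  induction t with
  | zero => rw [show X 0 = fun _ => x₀ from funext hX0]; exact measurable_const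
  | succ t ih =>
    have h1 : Measurable[⨆ i ∈ Set.Iio (t + 1), MeasurableSpace.comap (γ i) inferInstance]
        (X t) :=
      ih.mono (biSup_mono fun i hi => lt_trans hi (Nat.lt_succ_self t)) le_rfl
    have h2 : Measurable[⨆ i ∈ Set.Iio (t + 1), MeasurableSpace.comap (γ i) inferInstance]
        (γ t) :=
      (comap_measurable (γ t)).mono
        (le_biSup (fun i => MeasurableSpace.comap (γ i) inferInstance) (Nat.lt_succ_self t)) le_rfl
    rw [show X (t + 1) = fun ω => Function.uncurry step (X t ω, γ t ω) from funext (hX t)]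
    exact hstep.comp (h1.prodMk h2)

lemma chain_measurable (hγ : ∀ t, Measurable (γ t)) (hstep : Measurable (Function.uncurry step))
    (hX0 : ∀ ω, X 0 ω = x₀) (hX : ∀ t ω, X (t + 1) ω = step (X t ω) (γ t ω)) (t : ℕ) :
    Measurable (X t) :=
  (chain_measurable_past hstep hX0 hX t).mono
    (iSup₂_le fun i _ => (hγ i).comap_le) le_rfl

-- The state at time t is a function of the noise at times i < t, and disjoint blocks of an
-- independent family are independent.
omit [IsProbabilityMeasure P] in
lemma chain_indepFun (hγ : ∀ t, Measurable (γ t)) (hind : iIndepFun γ P)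
    (hstep : Measurable (Function.uncurry step))
    (hX0 : ∀ ω, X 0 ω = x₀) (hX : ∀ t ω, X (t + 1) ω = step (X t ω) (γ t ω)) (t : ℕ) :
    IndepFun (X t) (γ t) P := by
  have h := indep_iSup_of_disjoint (fun i => (hγ i).comap_le) hind.iIndep
    (S := Set.Iio t) (T := {t}) (by simp)
  rw [IndepFun_iff_Indep]
  refine indep_of_indep_of_le_left (indep_of_indep_of_le_right h ?_)
    (chain_measurable_past hstep hX0 hX t).comap_le
  exact le_biSup (fun i => MeasurableSpace.comap (γ i) inferInstance) (Set.mem_singleton t)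

/-- One-step Markov property of the marginals. -/
lemma chain_lintegral_succ (hγ : ∀ t, Measurable (γ t)) (hD : ∀ t, P.map (γ t) = D)
    (hind : iIndepFun γ P) (hstep : Measurable (Function.uncurry step))
    (hX0 : ∀ ω, X 0 ω = x₀) (hX : ∀ t ω, X (t + 1) ω = step (X t ω) (γ t ω)) (t : ℕ)
    {f : E → ENNReal} (hf : Measurable f) :
    ∫⁻ ω, f (X (t + 1) ω) ∂P = ∫⁻ ω, ∫⁻ g, f (step (X t ω) g) ∂D ∂P := by
  have hXt := chain_measurable hγ hstep hX0 hX t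
  have hDp : IsProbabilityMeasure D := by
    rw [← hD 0]; exact Measure.isProbabilityMeasure_map (hγ 0).aemeasurable
  have hmap := (chain_indepFun hγ hind hstep hX0 hX t).map_prod_eq_prod_map_map
    hXt.aemeasurable (hγ t).aemeasurable
  have hfs : Measurable fun p : E × Γ => f (step p.1 p.2) := hf.comp hstep
  calc ∫⁻ ω, f (X (t + 1) ω) ∂P = ∫⁻ ω, f (step (X t ω) (γ t ω)) ∂P := by simp_rw [hX]
    _ = ∫⁻ p, f (step p.1 p.2) ∂(P.map fun ω => (X t ω, γ t ω)) :=
        (lintegral_map hfs (hXt.prodMk (hγ t))).symm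
    _ = ∫⁻ x, ∫⁻ g, f (step x g) ∂D ∂(P.map (X t)) := by
        rw [hmap, hD t, lintegral_prod _ hfs.aemeasurable]
    _ = _ := lintegral_map hfs.lintegral_prod_right' hXt

/-- A chain is a family of random variables whose marginals are linked by the kernel `step`. -/
structure IsChain (D : Measure Γ) (P : Measure Ω) (step : E → Γ → E) (X : ℕ → Ω → E)
    (x₀ : E) (good : E → Prop) : Prop where
  start : ∀ ω, X 0 ω = x₀
  good : ∀ t ω, good (X t ω)
  meas : ∀ t, Measurable (X t)
  lintegral_succ : ∀ t (f : E → ENNReal), Measurable f →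
    ∫⁻ ω, f (X (t + 1) ω) ∂P = ∫⁻ ω, ∫⁻ g, f (step (X t ω) g) ∂D ∂P

variable {good : E → Prop}

/-- Geometric drift bound for a nonnegative Lyapunov function. -/
lemma IsChain.lintegral_le_of_drift (h : IsChain D P step X x₀ good) {V : E → ℝ}
    (hV : Measurable V) (hV0 : ∀ x, 0 ≤ V x) {ρ A : ℝ} (hρ : 0 ≤ ρ) (hρ1 : ρ ≤ 1) (hA : 0 ≤ A)
    (hdrift : ∀ x, good x →
      ∫⁻ g, ENNReal.ofReal (V (step x g)) ∂D ≤ ENNReal.ofReal (ρ * V x + A)) (t : ℕ) :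
    ∫⁻ ω, ENNReal.ofReal (V (X t ω)) ∂P ≤ ENNReal.ofReal (ρ ^ t * V x₀ + t * A) := by
  induction t with
  | zero => simp [h.start]
  | succ t ih =>
    rw [h.lintegral_succ t _ hV.ennreal_ofReal]
    calc _ ≤ ∫⁻ ω, (ENNReal.ofReal ρ * ENNReal.ofReal (V (X t ω)) + ENNReal.ofReal A) ∂P := by
          refine lintegral_mono fun ω => (hdrift _ (h.good t ω)).trans_eq ?_
          rw [ENNReal.ofReal_add (mul_nonneg hρ (hV0 _)) hA, ENNReal.ofReal_mul hρ]
      _ = ENNReal.ofReal ρ * ∫⁻ ω, ENNReal.ofReal (V (X t ω)) ∂P + ENNReal.ofReal A := by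
          have hm : Measurable fun ω => ENNReal.ofReal (V (X t ω)) :=
            (hV.comp (h.meas t)).ennreal_ofReal
          rw [lintegral_add_right _ measurable_const, lintegral_const_mul _ hm]
          simp
      _ ≤ ENNReal.ofReal ρ * ENNReal.ofReal (ρ ^ t * V x₀ + t * A) + ENNReal.ofReal A := by
          gcongr
      _ = ENNReal.ofReal (ρ * (ρ ^ t * V x₀ + t * A) + A) := by
          have : 0 ≤ ρ ^ t * V x₀ + t * A := by have := hV0 x₀; positivity
          rw [ENNReal.ofReal_add (mul_nonneg hρ this) hA, ENNReal.ofReal_mul hρ]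
      _ ≤ _ := by
          refine ENNReal.ofReal_le_ofReal ?_
          -- Linear growth in t replaces the geometric sum; this is affordable because `A` will be
          -- exponentially small relative to the threshold `v₀`.
          have : ρ * (t * A) ≤ t * A := mul_le_of_le_one_left (by positivity) hρ1
          rw [pow_succ]
          push_cast
          nlinarith

/-- Markov's inequality for a function of the state. -/
lemma IsChain.prob_le (h : IsChain D P step X x₀ good) {f : E → ENNReal} (hf : Measurable f)
    {t : ℕ} {B v : ℝ} (hB0 : 0 ≤ B) (hv : 0 < v)
    (hB : ∫⁻ ω, f (X t ω) ∂P ≤ ENNReal.ofReal B) :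
    P.real {ω | ENNReal.ofReal v ≤ f (X t ω)} ≤ B / v := by
  have h3 := (mul_meas_ge_le_lintegral (μ := P) (hf.comp (h.meas t)) (ENNReal.ofReal v)).trans hB
  change ENNReal.ofReal v * P {ω | ENNReal.ofReal v ≤ f (X t ω)} ≤ _ at h3
  rw [← ofReal_measureReal, ← ENNReal.ofReal_mul hv.le, ENNReal.ofReal_le_ofReal_iff hB0] at h3
  rw [le_div_iff₀ hv]
  linarith

/-- The truncated exponential moment of `W`. -/
noncomputable def truncExp (W : E → ℝ) (b θ : ℝ) (x : E) : ENNReal :=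
  {x | W x ≤ b}.indicator (fun x => ENNReal.ofReal (Real.exp (θ * W x))) x

lemma measurable_truncExp {W : E → ℝ} (hW : Measurable W) (b θ : ℝ) :
    Measurable (truncExp W b θ) :=
  ((hW.const_mul θ).exp.ennreal_ofReal).indicator (measurableSet_le hW measurable_const)

/-- Recursion for truncated exponential moments. -/
lemma IsChain.truncExp_succ [IsProbabilityMeasure D] (h : IsChain D P step X x₀ good)
    {W : E → ℝ} (hW : Measurable W) {b β θ G p r : ℝ} (hθ : 0 ≤ θ) (hG : 0 ≤ G) (hr : 0 ≤ r)
    {t : ℕ} (hp : P.real {ω | b < W (X t ω)} ≤ p) (hpθ : Real.exp (θ * b) * p ≤ 1)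
    (hone : ∀ x, good x → W x ≤ b →
      ∫⁻ g, ENNReal.ofReal (Real.exp (θ * W (step x g))) ∂D ≤
        ENNReal.ofReal (Real.exp G * (1 + Real.exp (β * θ * W x))))
    (hu : ∫⁻ ω, truncExp W b (β * θ) (X t ω) ∂P ≤ ENNReal.ofReal r) :
    ∫⁻ ω, truncExp W b θ (X (t + 1) ω) ∂P ≤ ENNReal.ofReal (Real.exp G * (2 + r)) := by
  rw [h.lintegral_succ t _ (measurable_truncExp hW b θ)]
  have hbd : ∀ x, truncExp W b θ x ≤ ENNReal.ofReal (Real.exp (θ * b)) := fun x => by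
    unfold truncExp
    by_cases hx : W x ≤ b
    · rw [Set.indicator_of_mem (show x ∈ {x | W x ≤ b} from hx)]
      exact ENNReal.ofReal_le_ofReal (Real.exp_le_exp.2 (mul_le_mul_of_nonneg_left hx hθ))
    · rw [Set.indicator_of_notMem (show x ∉ {x | W x ≤ b} from hx)]
      exact zero_le
  have hle : ∀ x, truncExp W b θ x ≤ ENNReal.ofReal (Real.exp (θ * W x)) := fun x =>
    Set.indicator_le_self _ _ _
  have hms : MeasurableSet {ω | b < W (X t ω)} :=
    measurableSet_lt measurable_const (hW.comp (h.meas t))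
  calc _ ≤ ∫⁻ ω, ({ω | b < W (X t ω)}.indicator
            (fun _ => ENNReal.ofReal (Real.exp (θ * b))) ω +
          (ENNReal.ofReal (Real.exp G) +
            ENNReal.ofReal (Real.exp G) * truncExp W b (β * θ) (X t ω))) ∂P := by
        refine lintegral_mono fun ω => ?_
        -- Inside the window the one-step hypothesis applies. Outside it, the truncated moment after
        -- the step is at most exp(θb), and this costs at most 1 in total because the outside has
        -- probability at most `p`.
        by_cases hx : W (X t ω) ≤ b
        · refine le_trans ?_ le_add_self
          refine (lintegral_mono fun g => hle _).trans ((hone _ (h.good t ω) hx).trans_eq ?_)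
          have : truncExp W b (β * θ) (X t ω) =
              ENNReal.ofReal (Real.exp (β * θ * W (X t ω))) := Set.indicator_of_mem
                (show X t ω ∈ {x | W x ≤ b} from hx) _
          rw [this, mul_add, mul_one, ENNReal.ofReal_add (by positivity) (by positivity),
            ENNReal.ofReal_mul (by positivity)]
        · refine le_trans ?_ le_self_add
          rw [Set.indicator_of_mem (show ω ∈ {ω | b < W (X t ω)} from not_le.1 hx)]
          refine (lintegral_mono fun g => hbd _).trans ?_
          simp
    _ = ENNReal.ofReal (Real.exp (θ * b)) * P {ω | b < W (X t ω)} + (ENNReal.ofReal (Real.exp G) +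
          ENNReal.ofReal (Real.exp G) * ∫⁻ ω, truncExp W b (β * θ) (X t ω) ∂P) := by
        have hm : Measurable fun ω => truncExp W b (β * θ) (X t ω) :=
          (measurable_truncExp hW b _).comp (h.meas t)
        rw [lintegral_add_left (measurable_const.indicator hms),
          lintegral_add_left measurable_const, lintegral_const_mul _ hm,
          lintegral_indicator_const hms]
        simp
    _ ≤ 1 + (ENNReal.ofReal (Real.exp G) +
          ENNReal.ofReal (Real.exp G) * ENNReal.ofReal r) := by
        gcongr
        rw [← ofReal_measureReal, ← ENNReal.ofReal_mul (by positivity), ← ENNReal.ofReal_one]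
        exact ENNReal.ofReal_le_ofReal
          ((mul_le_mul_of_nonneg_left hp (Real.exp_pos _).le).trans hpθ)
    _ = ENNReal.ofReal (1 + (Real.exp G + Real.exp G * r)) := by
        rw [ENNReal.ofReal_add (by positivity) (by positivity),
          ENNReal.ofReal_add (by positivity) (by positivity), ENNReal.ofReal_mul (by positivity),
          ENNReal.ofReal_one]
    _ ≤ _ := by
        refine ENNReal.ofReal_le_ofReal ?_
        have := Real.one_le_exp hG
        nlinarith

/-- Iterating the recursion for truncated exponential moments. -/
lemma IsChain.truncExp_le [IsProbabilityMeasure D] (h : IsChain D P step X x₀ good)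
    {W : E → ℝ} (hW : Measurable W) {b β D₁ D₂ d₁ d₂ p θm D₀ : ℝ} {n₁ T : ℕ} (hb : 0 ≤ b)
    (hβ : 0 ≤ β) (hβ1 : β ≤ 1) (hD₁ : 0 ≤ D₁) (hD₂ : 0 ≤ D₂) (hd₁ : 0 ≤ d₁) (hd₂ : 0 ≤ d₂)
    (hd₁' : D₁ ≤ (1 - β) * d₁) (hd₂' : D₂ ≤ (1 - β) * d₂) (hp0 : 0 ≤ p)
    (hp : ∀ t, n₁ ≤ t → t ≤ T → P.real {ω | b < W (X t ω)} ≤ p)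
    (hpθ : Real.exp (θm * b) * p ≤ 1)
    (hone : ∀ θ, 0 ≤ θ → θ ≤ θm → ∀ x, good x → W x ≤ b →
      ∫⁻ g, ENNReal.ofReal (Real.exp (θ * W (step x g))) ∂D ≤
        ENNReal.ofReal (Real.exp (D₁ * θ + D₂ * θ ^ 2) * (1 + Real.exp (β * θ * W x))))
    (hbase : ∀ ω, W (X n₁ ω) ≤ b → W (X n₁ ω) ≤ D₀) (n : ℕ) (hn : n₁ + n ≤ T)
    {θ : ℝ} (hθ : 0 ≤ θ) (hθm : θ ≤ θm) :
    ∫⁻ ω, truncExp W b θ (X (n₁ + n) ω) ∂P ≤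
      ENNReal.ofReal (Real.exp (d₁ * θ + d₂ * θ ^ 2) * (2 * n + Real.exp (θ * (D₀ * β ^ n)))) := by
  -- Each step trades θ for βθ, so the induction hypothesis is needed at a smaller parameter. The
  -- summand 2 per step pays for the excursions outside the window and for the 1 in `hone`.
  induction n generalizing θ with
  | zero =>
    have hle : ∀ ω, truncExp W b θ (X n₁ ω) ≤ ENNReal.ofReal (Real.exp (θ * D₀)) := fun ω => by
      unfold truncExp
      by_cases hx : W (X n₁ ω) ≤ b
      · rw [Set.indicator_of_mem (show X n₁ ω ∈ {x | W x ≤ b} from hx)]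
        exact ENNReal.ofReal_le_ofReal
          (Real.exp_le_exp.2 (mul_le_mul_of_nonneg_left (hbase ω hx) hθ))
      · rw [Set.indicator_of_notMem (show X n₁ ω ∉ {x | W x ≤ b} from hx)]
        exact zero_le
    refine (lintegral_mono hle).trans ?_
    simp only [lintegral_const, measure_univ, mul_one]
    refine ENNReal.ofReal_le_ofReal ?_
    have : 1 ≤ Real.exp (d₁ * θ + d₂ * θ ^ 2) := Real.one_le_exp (by positivity)
    simp only [CharP.cast_eq_zero, mul_zero, pow_zero, mul_one, zero_add]
    exact le_mul_of_one_le_left (Real.exp_pos _).le this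
  | succ n ih =>
    have hβθ : β * θ ≤ θ := mul_le_of_le_one_left hθ hβ1
    have h1 := ih (by omega) (mul_nonneg hβ hθ) (hβθ.trans hθm)
    have h2 := h.truncExp_succ hW (t := n₁ + n) (p := p) hθ
      (G := D₁ * θ + D₂ * θ ^ 2) (by positivity) (by positivity)
      (hp _ (by omega) (by omega))
      ((mul_le_mul_of_nonneg_right (Real.exp_le_exp.2
        (mul_le_mul_of_nonneg_right hθm hb)) hp0).trans hpθ) (hone θ hθ hθm) h1
    rw [← add_assoc]
    refine h2.trans (ENNReal.ofReal_le_ofReal ?_)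
    have e1 : β * θ * (D₀ * β ^ n) = θ * (D₀ * β ^ (n + 1)) := by ring
    rw [e1]
    set F := Real.exp (θ * (D₀ * β ^ (n + 1)))
    have hF : 0 ≤ F := (Real.exp_pos _).le
    set A := Real.exp (d₁ * (β * θ) + d₂ * (β * θ) ^ 2)
    have hA : 1 ≤ A := Real.one_le_exp (by positivity)
    -- The noise contributions form geometric series in β; `d₁` and `d₂` dominate their sums, the
    -- quadratic one through β² ≤ β.
    have h4 : Real.exp (D₁ * θ + D₂ * θ ^ 2) * A ≤ Real.exp (d₁ * θ + d₂ * θ ^ 2) := by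
      rw [← Real.exp_add]
      refine Real.exp_le_exp.2 ?_
      have k1 := mul_le_mul_of_nonneg_right hd₁' hθ
      have k2 := mul_le_mul_of_nonneg_right hd₂' (sq_nonneg θ)
      have k3 : β ^ 2 * (d₂ * θ ^ 2) ≤ β * (d₂ * θ ^ 2) :=
        mul_le_mul_of_nonneg_right (by nlinarith) (by positivity)
      nlinarith
    calc Real.exp (D₁ * θ + D₂ * θ ^ 2) * (2 + A * (2 * n + F))
        ≤ Real.exp (D₁ * θ + D₂ * θ ^ 2) * (A * (2 * (n + 1) + F)) := by
          refine mul_le_mul_of_nonneg_left ?_ (Real.exp_pos _).le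
          nlinarith
      _ = (Real.exp (D₁ * θ + D₂ * θ ^ 2) * A) * (2 * (n + 1) + F) := by ring
      _ ≤ Real.exp (d₁ * θ + d₂ * θ ^ 2) * (2 * (n + 1) + F) := by gcongr
      _ = _ := by push_cast; ring

/-- Tail bound for a chain: the Lyapunov function `V` brings `W` below `b` by time `n₁`, after
which `W` contracts at rate `β` up to sub-Gaussian noise. -/
theorem IsChain.tail_le [IsProbabilityMeasure D] (h : IsChain D P step X x₀ good)
    {V W : E → ℝ} (hV : Measurable V) (hW : Measurable W) (hV0 : ∀ x, 0 ≤ V x)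
    {ρ A v₀ b β D₁ D₂ d₁ d₂ p θ D₀ z : ℝ} {n₁ T : ℕ}
    (hρ : 0 ≤ ρ) (hρ1 : ρ ≤ 1) (hA : 0 ≤ A) (hv₀ : 0 < v₀)
    (hdrift : ∀ x, good x →
      ∫⁻ g, ENNReal.ofReal (V (step x g)) ∂D ≤ ENNReal.ofReal (ρ * V x + A))
    (hVW : ∀ x, good x → b < W x → v₀ ≤ V x) (hn₁ : ρ ^ n₁ * V x₀ ≤ 1)
    (hp : 1 + T * A ≤ p * v₀)
    (hb : 0 ≤ b)
    (hβ : 0 ≤ β) (hβ1 : β ≤ 1) (hD₁ : 0 ≤ D₁) (hD₂ : 0 ≤ D₂) (hd₁ : 0 ≤ d₁) (hd₂ : 0 ≤ d₂)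
    (hd₁' : D₁ ≤ (1 - β) * d₁) (hd₂' : D₂ ≤ (1 - β) * d₂)
    (hθ : 0 ≤ θ) (hpθ : Real.exp (θ * b) * p ≤ 1)
    (hone : ∀ θ', 0 ≤ θ' → θ' ≤ θ → ∀ x, good x → W x ≤ b →
      ∫⁻ g, ENNReal.ofReal (Real.exp (θ' * W (step x g))) ∂D ≤
        ENNReal.ofReal (Real.exp (D₁ * θ' + D₂ * θ' ^ 2) * (1 + Real.exp (β * θ' * W x))))
    (hbase : ∀ ω, W (X n₁ ω) ≤ b → W (X n₁ ω) ≤ D₀) (hD₀ : 0 ≤ D₀)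
    {t : ℕ} (ht₁ : n₁ ≤ t) (htT : t ≤ T) :
    P.real {ω | D₀ * β ^ (t - n₁) + z < W (X t ω)} ≤
      p + Real.exp (d₁ * θ + d₂ * θ ^ 2) * (2 * T + 1) * Real.exp (-(θ * z)) := by
  have hp0 : 0 ≤ p := by
    have : 0 < p * v₀ := lt_of_lt_of_le (by positivity) hp
    exact (pos_of_mul_pos_left this hv₀.le).le
  have hpt : ∀ t, n₁ ≤ t → t ≤ T → P.real {ω | b < W (X t ω)} ≤ p := fun t ht hT => by
    have h1 := h.prob_le hV.ennreal_ofReal (t := t) (B := ρ ^ t * V x₀ + t * A) (v := v₀)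
      (by have := hV0 x₀; positivity) hv₀ (h.lintegral_le_of_drift hV hV0 hρ hρ1 hA hdrift t)
    refine (measureReal_mono fun ω hω => ?_).trans (h1.trans ?_)
    · exact ENNReal.ofReal_le_ofReal (hVW _ (h.good t ω) hω)
    · rw [div_le_iff₀ hv₀]
      refine le_trans (add_le_add ?_ ?_) hp
      · exact (mul_le_mul_of_nonneg_right (pow_le_pow_of_le_one hρ hρ1 ht) (hV0 _)).trans hn₁
      · exact mul_le_mul_of_nonneg_right (by exact_mod_cast hT) hA
  obtain ⟨n, rfl⟩ := Nat.exists_eq_add_of_le ht₁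
  have hu := h.truncExp_le hW hb hβ hβ1 hD₁ hD₂ hd₁ hd₂ hd₁' hd₂' hp0 hpt hpθ hone hbase n htT
    hθ le_rfl
  rw [Nat.add_sub_cancel_left]
  have hm := h.prob_le (measurable_truncExp hW b θ) (t := n₁ + n)
    (v := Real.exp (θ * (D₀ * β ^ n + z))) (by positivity) (Real.exp_pos _) hu
  -- A large `W` is either outside the window, an event of probability at most `p`, or seen by the
  -- truncated exponential moment.
  have hsub : {ω | D₀ * β ^ n + z < W (X (n₁ + n) ω)} ⊆ {ω | b < W (X (n₁ + n) ω)} ∪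
      {ω | ENNReal.ofReal (Real.exp (θ * (D₀ * β ^ n + z))) ≤
        truncExp W b θ (X (n₁ + n) ω)} := fun ω hω => by
    by_cases hx : W (X (n₁ + n) ω) ≤ b
    · right
      have : truncExp W b θ (X (n₁ + n) ω) =
          ENNReal.ofReal (Real.exp (θ * W (X (n₁ + n) ω))) := Set.indicator_of_mem
            (show X (n₁ + n) ω ∈ {x | W x ≤ b} from hx) _
      rw [Set.mem_ofPred_eq, this]
      exact ENNReal.ofReal_le_ofReal (Real.exp_le_exp.2 (mul_le_mul_of_nonneg_left
        (le_of_lt hω) hθ))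
    · exact Or.inl (not_le.1 hx)
  refine (measureReal_mono hsub).trans ((measureReal_union_le _ _).trans
    (add_le_add (hpt _ ht₁ htT) (hm.trans ?_)))
  rw [div_eq_mul_inv, ← Real.exp_neg, mul_assoc, mul_assoc]
  refine mul_le_mul_of_nonneg_left ?_ (Real.exp_pos _).le
  have e1 : Real.exp (-(θ * (D₀ * β ^ n + z))) =
      Real.exp (-(θ * (D₀ * β ^ n))) * Real.exp (-(θ * z)) := by
    rw [← Real.exp_add]; ring_nf
  rw [e1, ← mul_assoc]
  refine mul_le_mul_of_nonneg_right ?_ (Real.exp_pos _).le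
  rw [add_mul, ← Real.exp_add, add_neg_cancel, Real.exp_zero]
  have h5 : Real.exp (-(θ * (D₀ * β ^ n))) ≤ 1 := Real.exp_le_one_iff.2 (by
    have : 0 ≤ θ * (D₀ * β ^ n) := by positivity
    linarith)
  have h6 : (n : ℝ) ≤ T := by exact_mod_cast (by omega : n ≤ T)
  have h7 := mul_le_mul_of_nonneg_left h5 (by positivity : (0 : ℝ) ≤ 2 * n)
  linarith

end Chain

/-! ### One step far from equilibrium: power moments -/

section OneStep

variable {Γ : Type*} [MeasurableSpace Γ] {D : Measure Γ} [IsProbabilityMeasure D]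
  {m : Γ → ℝ} {C h α k θ y : ℝ}

/-- Bennett-type bound for the moment generating function of a variable in `[0, C]`. -/
lemma lintegral_exp_mul_le (hm : Measurable m) (hm0 : ∀ g, 0 ≤ m g) (hmC : ∀ g, m g ≤ C)
    {a : ℝ} (ha : |a| * C ≤ 1) :
    ∫⁻ g, ENNReal.ofReal (Real.exp (a * m g)) ∂D ≤
      ENNReal.ofReal (Real.exp ((a + a ^ 2 * C) * ∫ g, m g ∂D)) := by
  have hint : Integrable m D := Integrable.of_bound hm.aestronglyMeasurable C
    (Filter.Eventually.of_forall fun g => by rw [Real.norm_eq_abs, abs_of_nonneg (hm0 g)]; exact hmC g)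
  -- This combines exp z ≤ 1 + z + z² for |z| ≤ 1 with m² ≤ Cm, so the variance is charged to the
  -- mean.
  have hle : ∀ g, Real.exp (a * m g) ≤ 1 + (a + a ^ 2 * C) * m g := fun g => by
    have h1 : |a * m g| ≤ 1 := by
      rw [abs_mul, abs_of_nonneg (hm0 g)]
      exact (mul_le_mul_of_nonneg_left (hmC g) (abs_nonneg a)).trans ha
    have h2 := (abs_le.1 (Real.abs_exp_sub_one_sub_id_le h1)).2
    have h3 : a ^ 2 * (m g * m g) ≤ a ^ 2 * (C * m g) :=
      mul_le_mul_of_nonneg_left (mul_le_mul_of_nonneg_right (hmC g) (hm0 g)) (sq_nonneg a)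
    nlinarith
  have hint2 : Integrable (fun g => 1 + (a + a ^ 2 * C) * m g) D :=
    (integrable_const 1).add (hint.const_mul _)
  calc _ ≤ ∫⁻ g, ENNReal.ofReal (1 + (a + a ^ 2 * C) * m g) ∂D :=
        lintegral_mono fun g => ENNReal.ofReal_le_ofReal (hle g)
    _ = ENNReal.ofReal (∫ g, (1 + (a + a ^ 2 * C) * m g) ∂D) :=
        (ofReal_integral_eq_lintegral_ofReal hint2 (Filter.Eventually.of_forall fun g =>
          (Real.exp_pos _).le.trans (hle g))).symm
    _ ≤ _ := by
        refine ENNReal.ofReal_le_ofReal ?_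
        rw [integral_add (integrable_const 1) (hint.const_mul _), integral_const_mul]
        simp only [integral_const, probReal_univ, smul_eq_mul, mul_one]
        linarith [Real.add_one_le_exp ((a + a ^ 2 * C) * ∫ g, m g ∂D)]

/-- Consequence for functions dominated by `exp (b + a m)`. -/
lemma lintegral_exp_affine_le (hm : Measurable m) (hm0 : ∀ g, 0 ≤ m g) (hmC : ∀ g, m g ≤ C)
    {a b r : ℝ} (ha : |a| * C ≤ 1) {f : Γ → ℝ} (hf : ∀ g, f g ≤ b + a * m g)
    (hr : b + (a + a ^ 2 * C) * ∫ g, m g ∂D ≤ r) :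
    ∫⁻ g, ENNReal.ofReal (Real.exp (f g)) ∂D ≤ ENNReal.ofReal (Real.exp r) := by
  have hmeas : Measurable fun g => ENNReal.ofReal (Real.exp (a * m g)) :=
    (hm.const_mul a).exp.ennreal_ofReal
  calc _ ≤ ∫⁻ g, ENNReal.ofReal (Real.exp b) * ENNReal.ofReal (Real.exp (a * m g)) ∂D := by
        refine lintegral_mono fun g => ?_
        rw [← ENNReal.ofReal_mul (Real.exp_pos _).le, ← Real.exp_add]
        exact ENNReal.ofReal_le_ofReal (Real.exp_le_exp.2 (hf g))
    _ = ENNReal.ofReal (Real.exp b) * ∫⁻ g, ENNReal.ofReal (Real.exp (a * m g)) ∂D :=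
        lintegral_const_mul _ hmeas
    _ ≤ ENNReal.ofReal (Real.exp b) *
          ENNReal.ofReal (Real.exp ((a + a ^ 2 * C) * ∫ g, m g ∂D)) := by
        gcongr; exact lintegral_exp_mul_le hm hm0 hmC ha
    _ ≤ _ := by
        rw [← ENNReal.ofReal_mul (Real.exp_pos _).le, ← Real.exp_add]
        exact ENNReal.ofReal_le_ofReal (Real.exp_le_exp.2 hr)

lemma lintegral_le_of_le_const {f : Γ → ℝ} {r : ℝ} (hf : ∀ g, f g ≤ r) :
    ∫⁻ g, ENNReal.ofReal (f g) ∂D ≤ ENNReal.ofReal r := by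
  refine (lintegral_mono fun g => ENNReal.ofReal_le_ofReal (hf g)).trans ?_
  simp

/-- Contraction of the power moment above the stationary level. -/
lemma one_step_upper_moment (hm : Measurable m) (hm0 : ∀ g, 0 ≤ m g) (hmC : ∀ g, m g ≤ C)
    (hh : 0 < h) (hC : 1 < C) (hα : 0 < α) (hα1 : α ≤ 1) (hhC : h * C ≤ α / 1000)
    (hk : 0 ≤ k) (hkhC : k * h * C ≤ α / 64) (hy : 0 < y)
    (he : 1 ≤ y → y * ∫ g, m g ∂D ≤ y - α * (y - 1)) :
    ∫⁻ g, ENNReal.ofReal (Real.exp (k * Real.log (y * ((1 - h) ^ 2 + 2 * h * m g) ^ 2))) ∂D ≤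
      ENNReal.ofReal (Real.exp (-(k * h * α)) * Real.exp (k * Real.log y) +
        Real.exp (k * Real.log 3)) := by
  have hhα : h ≤ α / 1000 := by nlinarith
  have hq : ∀ g, 0 < (1 - h) ^ 2 + 2 * h * m g := fun g => by
    have := mul_nonneg hh.le (hm0 g)
    nlinarith [pow_pos (show 0 < 1 - h by linarith) 2]
  -- For y ≥ 2 the drift gives E m ≤ 1 - α/2, which beats both h² and the variance term. For y ≤ 2
  -- one step multiplies y by at most 1.01², so it stays below 3.
  rcases le_total 2 y with h2 | h2
  · have he' := he (by linarith)
    set e := ∫ g, m g ∂D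
    have he0 : 0 ≤ e := integral_nonneg hm0
    have he1 : e ≤ 1 - α / 2 := by
      by_contra hlt
      push Not at hlt
      nlinarith
    refine (lintegral_exp_affine_le hm hm0 hmC (a := 4 * k * h)
      (b := k * Real.log y + k * (-(4 * h) + 2 * h ^ 2))
      (r := k * Real.log y - k * h * α) ?_ (fun g => ?_) ?_).trans ?_
    · rw [abs_of_nonneg (by positivity)]; linarith
    · rw [Real.log_mul hy.ne' (pow_pos (hq g) 2).ne', Real.log_pow]
      have := Real.log_le_sub_one_of_pos (hq g)
      have := mul_le_mul_of_nonneg_left this hk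
      push_cast
      nlinarith
    · have hkh : 0 ≤ k * h := by positivity
      change _ + (4 * k * h + (4 * k * h) ^ 2 * C) * e ≤ _
      have e1 : (4 * k * h + (4 * k * h) ^ 2 * C) * e = k * h * ((4 + 16 * (k * h * C)) * e) := by
        ring
      have e2 : (4 + 16 * (k * h * C)) * e ≤ (4 + α / 4) * (1 - α / 2) :=
        mul_le_mul (by linarith) he1 he0 (by positivity)
      have e3 := mul_le_mul_of_nonneg_left e2 hkh
      rw [e1]
      have e4 : 0 ≤ k * h * (4 - 2 * h - α - (4 + α / 4) * (1 - α / 2)) :=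
        mul_nonneg hkh (by nlinarith)
      nlinarith
    · refine ENNReal.ofReal_le_ofReal ?_
      rw [← Real.exp_add]
      have : k * Real.log y - k * h * α = -(k * h * α) + k * Real.log y := by ring
      rw [this]
      linarith [Real.exp_pos (k * Real.log 3)]
  · refine lintegral_le_of_le_const fun g => ?_
    have h1 : y * ((1 - h) ^ 2 + 2 * h * m g) ^ 2 ≤ 3 := by
      have a1 : (1 - h) ^ 2 + 2 * h * m g ≤ 1.01 := by
        have := mul_le_mul_of_nonneg_left (hmC g) hh.le
        nlinarith
      have a2 : ((1 - h) ^ 2 + 2 * h * m g) ^ 2 ≤ 1.01 ^ 2 := pow_le_pow_left₀ (hq g).le a1 2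
      nlinarith
    have h3 := Real.log_le_log (mul_pos hy (pow_pos (hq g) 2)) h1
    have h4 := Real.exp_le_exp.2 (mul_le_mul_of_nonneg_left h3 hk)
    have : 0 ≤ Real.exp (-(k * h * α)) * Real.exp (k * Real.log y) := by positivity
    linarith

/-- Contraction of the inverse power moment below the stationary level. -/
lemma one_step_lower_moment (hm : Measurable m) (hm0 : ∀ g, 0 ≤ m g) (hmC : ∀ g, m g ≤ C)
    (hh : 0 < h) (hC : 1 < C) (hα : 0 < α) (hα1 : α ≤ 1) (hhC : h * C ≤ α / 1000)
    (hk : 0 ≤ k) (hkhC : k * h * C ≤ α / 64) (hy : 0 < y)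
    (he : y ≤ 1 → y + α * min (1 - y) y ≤ y * ∫ g, m g ∂D) :
    ∫⁻ g, ENNReal.ofReal (Real.exp (-k * Real.log (y * ((1 - h) ^ 2 + 2 * h * m g) ^ 2))) ∂D ≤
      ENNReal.ofReal (Real.exp (-(k * h * α)) * Real.exp (-k * Real.log y) +
        Real.exp (k * Real.log (5 / 3))) := by
  have hhα : h ≤ α / 1000 := by nlinarith
  have hq1 : ∀ g, (1 - h) ^ 2 ≤ (1 - h) ^ 2 + 2 * h * m g := fun g => by
    have := mul_nonneg hh.le (hm0 g)
    linarith
  have hq0 : 0.99 ≤ (1 - h) ^ 2 := by nlinarith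
  have hq : ∀ g, 0 < (1 - h) ^ 2 + 2 * h * m g := fun g => by linarith [hq1 g]
  -- For y ≤ 2/3 the minimum is at least y/2, so E m ≥ 1 + α/2. For y ≥ 2/3 one step loses at most
  -- the factor 0.99², so y stays above 3/5.
  rcases le_total y (2 / 3) with h2 | h2
  · have he' := he (by linarith)
    set e := ∫ g, m g ∂D
    have he1 : 1 + α / 2 ≤ e := by
      have : y / 2 ≤ min (1 - y) y := le_min (by linarith) (by linarith)
      have h3 := mul_le_mul_of_nonneg_left this hα.le
      by_contra hlt
      push Not at hlt
      nlinarith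
    have hkh : 0 ≤ k * h := by positivity
    refine (lintegral_exp_affine_le hm hm0 hmC (a := -(4 * k * h * (1 - 8 * (h * C))))
      (b := -k * Real.log y + k * (4 * h + 32 * h ^ 2))
      (r := -k * Real.log y - k * h * α) ?_ (fun g => ?_) ?_).trans ?_
    · rw [abs_neg, abs_of_nonneg (mul_nonneg (by positivity) (by linarith))]
      have : k * h * C * (1 - 8 * (h * C)) ≤ k * h * C :=
        mul_le_of_le_one_right (by positivity) (by
          have : 0 < h * C := by positivity
          linarith)
      nlinarith
    · rw [Real.log_mul hy.ne' (pow_pos (hq g) 2).ne', Real.log_pow]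
      -- With 1 + v the factor being squared, log(1 + v) ≥ v/(1 + v) ≥ v - 2v², and v² is made
      -- affine in m by m² ≤ Cm. The resulting correction to the coefficient of m is the factor 1 -
      -- 8hC in `a`.
      have hl : (-(2 * h) + h ^ 2 + 2 * h * m g) - 2 * (8 * h ^ 2 * C * m g + 8 * h ^ 2) ≤
          Real.log ((1 - h) ^ 2 + 2 * h * m g) := by
        refine le_trans ?_ (Real.one_sub_inv_le_log_of_pos (hq g))
        obtain ⟨v, hv⟩ : ∃ v, v = -(2 * h) + h ^ 2 + 2 * h * m g := ⟨_, rfl⟩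
        have hqv : (1 - h) ^ 2 + 2 * h * m g = 1 + v := by rw [hv]; ring
        have hmg := hm0 g
        have hv2 : v ^ 2 ≤ 8 * h ^ 2 * C * m g + 8 * h ^ 2 := by
          have c1 : h ^ 2 * (m g * m g) ≤ h ^ 2 * (C * m g) :=
            mul_le_mul_of_nonneg_left (mul_le_mul_of_nonneg_right (hmC g) hmg) (sq_nonneg h)
          have c2 : v ^ 2 ≤ (2 * h * m g + 2 * h) ^ 2 := by
            apply sq_le_sq'
            · rw [hv]; nlinarith [mul_nonneg hh.le hmg]
            · rw [hv]; nlinarith [mul_nonneg hh.le hmg]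
          nlinarith [sq_nonneg (2 * h * m g - 2 * h)]
        have hqp := hq g
        have hqq : 0.99 ≤ 1 + v := by linarith [hq1 g]
        rw [hqv, ← hv]
        have : 1 - (1 + v)⁻¹ = v / (1 + v) := by field_simp; ring
        rw [this, le_div_iff₀ (by linarith)]
        have c3 : 0 ≤ (8 * h ^ 2 * C * m g + 8 * h ^ 2 - v ^ 2) * (1 + v) :=
          mul_nonneg (by linarith) (by linarith)
        nlinarith [sq_nonneg v]
      have := mul_le_mul_of_nonneg_left hl hk
      push_cast
      nlinarith [mul_nonneg hk (sq_nonneg h)]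
    · change _ + (-(4 * k * h * (1 - 8 * (h * C))) + (-(4 * k * h * (1 - 8 * (h * C)))) ^ 2 * C) * e
        ≤ _
      have hhC0 : 0 < h * C := by positivity
      obtain ⟨w, hw⟩ : ∃ w, w = 1 - 8 * (h * C) := ⟨_, rfl⟩
      have hw1 : w ≤ 1 := by linarith
      have hw0 : 1 - α / 125 ≤ w := by linarith
      obtain ⟨κ, hκ⟩ : ∃ κ, κ = k * h * C := ⟨_, rfl⟩
      have hκ0 : 0 ≤ κ := by rw [hκ]; positivity
      rw [← hw]
      have e1 : (-(4 * k * h * w) + (-(4 * k * h * w)) ^ 2 * C) * e =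
          -(k * h * ((4 * w - 16 * κ * w ^ 2) * e)) := by rw [hκ]; ring
      rw [e1]
      have e2 : 4 - 2 * α / 7 ≤ 4 * w - 16 * κ * w ^ 2 := by
        have : κ * w ^ 2 ≤ α / 64 * 1 :=
          mul_le_mul (by linarith) (by nlinarith) (sq_nonneg w) (by positivity)
        nlinarith
      have e3 : (4 - 2 * α / 7) * (1 + α / 2) ≤ (4 * w - 16 * κ * w ^ 2) * e :=
        mul_le_mul e2 he1 (by positivity) (by linarith)
      have e4 := mul_le_mul_of_nonneg_left e3 hkh
      have e5 : 0 ≤ k * h * ((4 - 2 * α / 7) * (1 + α / 2) - 4 - 32 * h - α) :=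
        mul_nonneg hkh (by nlinarith)
      nlinarith
    · refine ENNReal.ofReal_le_ofReal ?_
      rw [← Real.exp_add]
      have : -k * Real.log y - k * h * α = -(k * h * α) + -k * Real.log y := by ring
      rw [this]
      linarith [Real.exp_pos (k * Real.log (5 / 3))]
  · refine lintegral_le_of_le_const fun g => ?_
    have h1 : (5 / 3 : ℝ)⁻¹ ≤ y * ((1 - h) ^ 2 + 2 * h * m g) ^ 2 := by
      have a2 : 0.99 ^ 2 ≤ ((1 - h) ^ 2 + 2 * h * m g) ^ 2 :=
        pow_le_pow_left₀ (by norm_num) (by linarith [hq1 g]) 2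
      nlinarith
    have h3 := Real.log_le_log (by norm_num) h1
    rw [Real.log_inv] at h3
    have h4 := mul_le_mul_of_nonneg_left h3 hk
    have h5 := Real.exp_le_exp.2
      (show -k * Real.log (y * ((1 - h) ^ 2 + 2 * h * m g) ^ 2) ≤ k * Real.log (5 / 3) by linarith)
    have : 0 ≤ Real.exp (-(k * h * α)) * Real.exp (-k * Real.log y) := by positivity
    linarith

end OneStep

/-! ### One step inside the window: exponential moments of the excess -/

section OneStepExp

variable {Γ : Type*} [MeasurableSpace Γ] {D : Measure Γ} [IsProbabilityMeasure D]
  {m : Γ → ℝ} {C h α β θ y : ℝ}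

/-- One-step bound for the exponential moment of the excess over the stationary level. -/
lemma one_step_upper_exp (hm : Measurable m) (hm0 : ∀ g, 0 ≤ m g) (hmC : ∀ g, m g ≤ C)
    (hh : 0 < h) (hC : 1 < C) (hα : 0 < α) (hα1 : α ≤ 1) (hhC : h * C ≤ α / 1000)
    (hβ : β = 1 - 2 * h ^ 2 + h ^ 4 - 4 * h * α * (1 - h) ^ 2)
    (hθ : 0 ≤ θ) (hθhC : θ * h * C ≤ 1 / 1000) (hy : 0 < y) (hy9 : y ≤ 9)
    (he : 1 ≤ y → y * ∫ g, m g ∂D ≤ y - α * (y - 1)) (he' : y ≤ 1 → y * ∫ g, m g ∂D ≤ 1) :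
    ∫⁻ g, ENNReal.ofReal (Real.exp (θ * (y * ((1 - h) ^ 2 + 2 * h * m g) ^ 2 - 1))) ∂D ≤
      ENNReal.ofReal (Real.exp (36 * h ^ 2 * C * θ + 5184 * h ^ 2 * C * θ ^ 2) *
        (1 + Real.exp (β * θ * (y - 1)))) := by
  have hhα : h ≤ α / 1000 := by nlinarith
  have hhC0 : 0 < h * C := by positivity
  set e := ∫ g, m g ∂D
  have he0 : 0 ≤ e := integral_nonneg hm0
  -- Expanding the square and using hm² ≤ hCm gives the affine majorant (1 - h)⁴ + 4hcm.
  obtain ⟨c, hc⟩ : ∃ c, c = (1 - h) ^ 2 + h * C := ⟨_, rfl⟩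
  have hc0 : 0 ≤ c := by rw [hc]; positivity
  have hc1 : c ≤ 1.01 := by rw [hc]; nlinarith
  have hθh : 0 ≤ θ * h := by positivity
  have key : ∀ w s, 0 ≤ w → w ≤ 9 → y * e ≤ w →
      y * (1 - h) ^ 4 - 1 + 4 * h * (1 - h) ^ 2 * w ≤ s →
      ∫⁻ g, ENNReal.ofReal (Real.exp (θ * (y * ((1 - h) ^ 2 + 2 * h * m g) ^ 2 - 1))) ∂D ≤
        ENNReal.ofReal (Real.exp (36 * h ^ 2 * C * θ + 5184 * h ^ 2 * C * θ ^ 2 + θ * s)) := by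
    intro w s hw0 hw9 hyw hs
    refine lintegral_exp_affine_le hm hm0 hmC (a := θ * y * (4 * h * c))
      (b := θ * (y * (1 - h) ^ 4 - 1)) ?_ (fun g => ?_) ?_
    · rw [abs_of_nonneg (by positivity)]
      have : y * c ≤ 9 * 1.01 := mul_le_mul hy9 hc1 hc0 (by norm_num)
      have := mul_le_mul_of_nonneg_left this (show 0 ≤ θ * h * C by positivity)
      nlinarith
    · have c1 : h * (m g * m g) ≤ h * (C * m g) :=
        mul_le_mul_of_nonneg_left (mul_le_mul_of_nonneg_right (hmC g) (hm0 g)) hh.le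
      have c2 : ((1 - h) ^ 2 + 2 * h * m g) ^ 2 ≤ (1 - h) ^ 4 + 4 * h * c * m g := by
        rw [hc]; nlinarith
      have c3 := mul_le_mul_of_nonneg_left (mul_le_mul_of_nonneg_left c2 hy.le) hθ
      nlinarith
    · change _ + _ * e ≤ _
      have e1 : (θ * y * (4 * h * c) + (θ * y * (4 * h * c)) ^ 2 * C) * e =
          θ * h * (4 * c * (y * e)) + (θ * h) ^ 2 * C * (16 * (y * (c ^ 2 * (y * e)))) := by ring
      rw [e1]
      have hye : 0 ≤ y * e := by positivity
      have d1 : c * (y * e) ≤ (1 - h) ^ 2 * w + h * C * 9 := by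
        rw [hc]
        have k1 := mul_le_mul_of_nonneg_left hyw (sq_nonneg (1 - h))
        have k2 := mul_le_mul_of_nonneg_left (hyw.trans hw9) hhC0.le
        linarith
      have d2 : y * (c ^ 2 * (y * e)) ≤ 9 * (1.01 ^ 2 * 9) :=
        mul_le_mul hy9 (mul_le_mul (pow_le_pow_left₀ hc0 hc1 2) (hyw.trans hw9) hye
          (by norm_num)) (by positivity) (by norm_num)
      have d1' := mul_le_mul_of_nonneg_left d1 hθh
      have hK : 0 ≤ (θ * h) ^ 2 * C := by positivity
      have d2' := mul_le_mul_of_nonneg_left d2 hK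
      have hs' := mul_le_mul_of_nonneg_left hs hθ
      nlinarith
  rcases le_total 1 y with h1 | h1
  · refine (key (y - α * (y - 1)) (β * (y - 1)) (by nlinarith) (by nlinarith) (he h1) ?_).trans ?_
    -- Since (1 - h)⁴ + 4h(1 - h)² = (1 - h²)², the left side is β(y - 1) + (1 - h²)² - 1.
    · rw [hβ]
      nlinarith [pow_nonneg hh.le 4, pow_le_one₀ hh.le (show h ≤ 1 by linarith) (n := 2)]
    · refine ENNReal.ofReal_le_ofReal ?_
      rw [Real.exp_add, show θ * (β * (y - 1)) = β * θ * (y - 1) by ring]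
      exact mul_le_mul_of_nonneg_left (by linarith) (Real.exp_pos _).le
  · refine (key 1 0 zero_le_one (by norm_num) (he' h1) ?_).trans ?_
    · have : y * (1 - h) ^ 4 ≤ 1 * (1 - h) ^ 4 := mul_le_mul_of_nonneg_right h1 (by positivity)
      nlinarith [pow_nonneg hh.le 4, pow_le_one₀ hh.le (show h ≤ 1 by linarith) (n := 2)]
    · refine ENNReal.ofReal_le_ofReal ?_
      rw [mul_zero, add_zero]
      exact le_mul_of_one_le_right (Real.exp_pos _).le
        (by linarith [Real.exp_pos (β * θ * (y - 1))])

/-- One-step bound for the exponential moment of the deficit below the stationary level. -/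
lemma one_step_lower_exp (hm : Measurable m) (hm0 : ∀ g, 0 ≤ m g) (hmC : ∀ g, m g ≤ C)
    (hh : 0 < h) (hC : 1 < C) (hα : 0 < α) (hα1 : α ≤ 1) (hhC : h * C ≤ α / 1000)
    (hβ : β = 1 - 2 * h ^ 2 + h ^ 4 - 4 * h * α * (1 - h) ^ 2)
    (hθ : 0 ≤ θ) (hθhC : θ * h * C ≤ 1 / 1000) (hy : 1 / 2 ≤ y)
    (he : y ≤ 1 → y + α * min (1 - y) y ≤ y * ∫ g, m g ∂D)
    (he' : 1 ≤ y → 1 ≤ y * ∫ g, m g ∂D) :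
    ∫⁻ g, ENNReal.ofReal (Real.exp (θ * (1 - y * ((1 - h) ^ 2 + 2 * h * m g) ^ 2))) ∂D ≤
      ENNReal.ofReal (Real.exp (36 * h ^ 2 * C * θ + 5184 * h ^ 2 * C * θ ^ 2) *
        (1 + Real.exp (β * θ * (1 - y)))) := by
  have hhα : h ≤ α / 1000 := by nlinarith
  have hy0 : 0 < y := by linarith
  have hG : 0 ≤ 36 * h ^ 2 * C * θ + 5184 * h ^ 2 * C * θ ^ 2 := by positivity
  have hqlow : ∀ g, (1 - h) ^ 4 + 4 * h * (1 - h) ^ 2 * m g ≤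
      ((1 - h) ^ 2 + 2 * h * m g) ^ 2 := fun g => by
    nlinarith [sq_nonneg (h * m g)]
  -- From y ≥ 2 a single step cannot take y below 1, so the deficit is nonpositive and no drift is
  -- needed.
  rcases le_total 2 y with h2 | h2
  · refine lintegral_le_of_le_const fun g => ?_
    have h3 : 1 ≤ y * ((1 - h) ^ 2 + 2 * h * m g) ^ 2 := by
      have a1 : 0.99 ≤ (1 - h) ^ 2 := by nlinarith
      have a2 : 0.99 ≤ (1 - h) ^ 2 + 2 * h * m g := by
        have := mul_nonneg hh.le (hm0 g)
        linarith
      have a3 : 0.99 ^ 2 ≤ ((1 - h) ^ 2 + 2 * h * m g) ^ 2 := pow_le_pow_left₀ (by norm_num) a2 2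
      nlinarith
    have h4 : Real.exp (θ * (1 - y * ((1 - h) ^ 2 + 2 * h * m g) ^ 2)) ≤ 1 :=
      Real.exp_le_one_iff.2 (mul_nonpos_of_nonneg_of_nonpos hθ (by linarith))
    have h5 := Real.one_le_exp hG
    have h6 := Real.exp_pos (β * θ * (1 - y))
    nlinarith
  set e := ∫ g, m g ∂D
  have he0 : 0 ≤ e := integral_nonneg hm0
  have hθh : 0 ≤ θ * h := by positivity
  obtain ⟨c, hc⟩ : ∃ c, c = (1 - h) ^ 2 := ⟨_, rfl⟩
  have hc0 : 0 ≤ c := by rw [hc]; positivity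
  have hc1 : c ≤ 1 := by rw [hc]; nlinarith
  have key : ∀ w s, 0 ≤ w → w ≤ 1 → w ≤ y * e →
      1 - y * (1 - h) ^ 4 - 4 * h * (1 - h) ^ 2 * w ≤ 36 * h ^ 2 * C + s →
      ∫⁻ g, ENNReal.ofReal (Real.exp (θ * (1 - y * ((1 - h) ^ 2 + 2 * h * m g) ^ 2))) ∂D ≤
        ENNReal.ofReal (Real.exp (36 * h ^ 2 * C * θ + 5184 * h ^ 2 * C * θ ^ 2 + θ * s)) := by
    intro w s hw0 hw9 hyw hs
    have hyc : y * c ≤ 2 * 1 := mul_le_mul h2 hc1 hc0 (by norm_num)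
    have hyc0 : 0 ≤ y * c := by positivity
    have hAC : (θ * h * C) * (4 * (y * c)) ≤ 1 / 1000 * 8 :=
      mul_le_mul hθhC (by linarith) (by positivity) (by norm_num)
    refine lintegral_exp_affine_le hm hm0 hmC (a := -(θ * y * (4 * h * c)))
      (b := θ * (1 - y * (1 - h) ^ 4)) ?_ (fun g => ?_) ?_
    · rw [abs_neg, abs_of_nonneg (by positivity)]
      nlinarith
    · have c3 := mul_le_mul_of_nonneg_left (mul_le_mul_of_nonneg_left (hqlow g) hy0.le) hθ
      rw [hc]
      nlinarith
    · change _ + _ * e ≤ _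
      obtain ⟨A, hA⟩ : ∃ A, A = (θ * h * C) * (4 * (y * c)) := ⟨_, rfl⟩
      have hA0 : 0 ≤ A := by rw [hA]; positivity
      have hA8 : A ≤ 8 * (θ * h * C) := by
        rw [hA]
        have := mul_le_mul_of_nonneg_left hyc (show 0 ≤ θ * h * C by positivity)
        linarith
      have e1 : (-(θ * y * (4 * h * c)) + (-(θ * y * (4 * h * c))) ^ 2 * C) * e =
          -(θ * h * (4 * c) * ((1 - A) * (y * e))) := by rw [hA]; ring
      rw [e1]
      have d1 : (1 - A) * w ≤ (1 - A) * (y * e) :=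
        mul_le_mul_of_nonneg_left hyw (by linarith)
      have d2 : w - 8 * (θ * h * C) ≤ (1 - A) * w := by nlinarith
      have d3 := mul_le_mul_of_nonneg_left (d2.trans d1)
        (show 0 ≤ θ * h * (4 * c) by positivity)
      have d4 : θ * h * (4 * c) * (8 * (θ * h * C)) ≤ θ * h * (4 * 1) * (8 * (θ * h * C)) := by
        gcongr
      have hs' := mul_le_mul_of_nonneg_left hs hθ
      rw [← hc] at hs'
      have : 0 ≤ h ^ 2 * C * θ ^ 2 := by positivity
      nlinarith
  have hh2C : h ^ 2 ≤ h ^ 2 * C := le_mul_of_one_le_right (sq_nonneg h) hC.le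
  rcases le_total y 1 with h1 | h1
  -- The window y ≥ 1/2 is exactly what makes the drift proportional to the deficit. The remainder 1
  -- - (1 - h²)² ≤ 2h² is absorbed by the 36h²C in `key`.
  · have hmin : min (1 - y) y = 1 - y := min_eq_left (by linarith)
    have he := he h1
    rw [hmin] at he
    have hα1' := mul_le_mul_of_nonneg_right hα1 (sub_nonneg.2 h1)
    refine (key (y + α * (1 - y)) (β * (1 - y))
      (add_nonneg hy0.le (mul_nonneg hα.le (sub_nonneg.2 h1))) (by linarith) he ?_).trans ?_
    · rw [hβ]
      linarith [pow_nonneg hh.le 4, sq_nonneg h]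
    · refine ENNReal.ofReal_le_ofReal ?_
      rw [Real.exp_add, show θ * (β * (1 - y)) = β * θ * (1 - y) by ring]
      exact mul_le_mul_of_nonneg_left (by linarith) (Real.exp_pos _).le
  · refine (key 1 0 zero_le_one le_rfl (he' h1) ?_).trans ?_
    · have : 1 * (1 - h) ^ 4 ≤ y * (1 - h) ^ 4 := mul_le_mul_of_nonneg_right h1 (by positivity)
      nlinarith [pow_nonneg hh.le 4]
    · refine ENNReal.ofReal_le_ofReal ?_
      rw [mul_zero, add_zero]
      exact le_mul_of_one_le_right (Real.exp_pos _).le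
        (by linarith [Real.exp_pos (β * θ * (1 - y))])

end OneStepExp

/-! ### Scale invariance and the evolution of the norm -/

section Geometry

variable {d : ℕ} {f : EuclideanSpace ℝ (Fin d) → ℝ} {x : EuclideanSpace ℝ (Fin d)}
  {C η lam : ℝ}

/-- A scale invariant function is constant along rays, so its radial derivative vanishes; the
gradient step and the weight decay then add by Pythagoras. -/
lemma ScaleInvariant.inner_gradient_eq_zero (hf : ScaleInvariant f) (hx : x ≠ 0)
    (hd : DifferentiableAt ℝ f x) : inner ℝ (gradient f x) x = 0 := by
  have h1 : HasDerivAt (fun c : ℝ => f (c • x)) (fderiv ℝ f x x) 1 := by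
    have hc : HasDerivAt (fun c : ℝ => c • x) x 1 := by
      simpa using (hasDerivAt_id (1 : ℝ)).smul_const x
    have hd' : HasFDerivAt f (fderiv ℝ f x) ((1 : ℝ) • x) := by
      rw [one_smul]; exact hd.hasFDerivAt
    exact hd'.comp_hasDerivAt (1 : ℝ) hc
  have h2 : HasDerivAt (fun c : ℝ => f (c • x)) 0 1 := by
    refine (hasDerivAt_const (1 : ℝ) (f x)).congr_of_eventuallyEq ?_
    filter_upwards [lt_mem_nhds (zero_lt_one (α := ℝ))] with c hc
    exact hf c hc x hx
  have h3 := h1.unique h2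
  rw [gradient, InnerProductSpace.toDual_symm_apply, h3]

lemma ScaleInvariant.gradient_smul (hf : ScaleInvariant f) (hx : x ≠ 0) {c : ℝ} (hc : 0 < c) :
    c • gradient f (c • x) = gradient f x := by
  have h1 : (fun y => f (c • y)) =ᶠ[nhds x] f := by
    filter_upwards [isOpen_ne.mem_nhds hx] with y hy
    exact hf c hc y hy
  have h2 := h1.fderiv_eq (𝕜 := ℝ)
  rw [show (fun y => f (c • y)) = (f <| c • ·) from rfl, fderiv_comp_smul] at h2
  rw [gradient, gradient, ← h2, map_smul]

/-- The clipped relative squared gradient norm driving the scaled norm. -/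
noncomputable def clippedRatio (C η lam : ℝ) (f : EuclideanSpace ℝ (Fin d) → ℝ)
    (x : EuclideanSpace ℝ (Fin d)) : ℝ :=
  min C (‖gradient f (‖x‖⁻¹ • x)‖ ^ 2 / scaledNorm η lam x ^ 2)

lemma scaledNorm_pos (hη : 0 < η) (hlam : 0 < lam) (hx : x ≠ 0) : 0 < scaledNorm η lam x := by
  have := norm_pos_iff.2 hx
  unfold scaledNorm
  positivity

lemma clippedRatio_nonneg (hC : 0 ≤ C) : 0 ≤ clippedRatio C η lam f x :=
  le_min hC (by positivity)

/-- The squared norm after one step. -/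
lemma norm_sq_clippedStep (hf : ScaleInvariant f) (hx : x ≠ 0) (hd : DifferentiableAt ℝ f x) :
    ‖clippedStep C η lam f x‖ ^ 2 = (1 - η * lam) ^ 2 * ‖x‖ ^ 2 +
      (η * min (Real.sqrt (2 * C * lam / η) * ‖x‖) ‖gradient f x‖) ^ 2 := by
  have horth := hf.inner_gradient_eq_zero hx hd
  unfold clippedStep
  rw [norm_sub_sq_real, real_inner_smul_left, real_inner_smul_right, real_inner_smul_right,
    real_inner_comm, horth]
  simp only [mul_zero, sub_zero]
  rw [norm_smul, norm_smul, norm_smul, mul_pow, Real.norm_eq_abs, sq_abs]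
  congr 1
  rcases eq_or_ne (gradient f x) 0 with h0 | h0
  · rw [h0]
    simp only [norm_zero, mul_zero]
    rw [min_eq_right (by positivity)]
    ring
  · have h1 : ‖gradient f x‖ ≠ 0 := norm_ne_zero_iff.2 h0
    rw [norm_inv, norm_norm, inv_mul_cancel₀ h1, mul_one, Real.norm_eq_abs, sq_abs]

/-- The evolution of the squared scaled norm. -/
lemma scaledNorm_clippedStep (hf : ScaleInvariant f) (hx : x ≠ 0) (hd : DifferentiableAt ℝ f x)
    (hC : 0 < C) (hη : 0 < η) (hlam : 0 < lam) :
    scaledNorm η lam (clippedStep C η lam f x) ^ 2 = scaledNorm η lam x ^ 2 *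
      ((1 - η * lam) ^ 2 + 2 * (η * lam) * clippedRatio C η lam f x) ^ 2 := by
  have hn : 0 < ‖x‖ := norm_pos_iff.2 hx
  have hgr : ‖gradient f x‖ = ‖gradient f (‖x‖⁻¹ • x)‖ / ‖x‖ := by
    have h1 := hf.gradient_smul hx (inv_pos.2 hn)
    rw [← h1, norm_smul, norm_inv, norm_norm]
    field_simp
  have hS : scaledNorm η lam x ^ 2 = 2 * lam / η * ‖x‖ ^ 4 := by
    unfold scaledNorm
    rw [mul_pow, Real.sq_sqrt (by positivity)]
    ring
  -- Squared and divided by 2λ‖x‖²/η, the two arguments of the minimum become C and τ²/R², with τ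
  -- the gradient norm at x/‖x‖.
  have hN : (η * min (Real.sqrt (2 * C * lam / η) * ‖x‖) ‖gradient f x‖) ^ 2 =
      2 * (η * lam) * clippedRatio C η lam f x * ‖x‖ ^ 2 := by
    unfold clippedRatio
    rw [hS, hgr]
    set τ := ‖gradient f (‖x‖⁻¹ • x)‖
    have hτ : 0 ≤ τ := norm_nonneg _
    have hsq : (Real.sqrt (2 * C * lam / η) * ‖x‖) ^ 2 = 2 * C * lam / η * ‖x‖ ^ 2 := by
      rw [mul_pow, Real.sq_sqrt (by positivity)]
    have hsq' : (τ / ‖x‖) ^ 2 = τ ^ 2 / (2 * lam / η * ‖x‖ ^ 4) * (2 * lam / η * ‖x‖ ^ 2) := by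
      field_simp
    have hK : 0 < 2 * lam / η * ‖x‖ ^ 2 := by positivity
    rcases le_total (Real.sqrt (2 * C * lam / η) * ‖x‖) (τ / ‖x‖) with h | h
    · have h2 := pow_le_pow_left₀ (by positivity) h 2
      rw [hsq, hsq', show 2 * C * lam / η * ‖x‖ ^ 2 = C * (2 * lam / η * ‖x‖ ^ 2) by ring] at h2
      rw [min_eq_left h, min_eq_left (le_of_mul_le_mul_right h2 hK), mul_pow, hsq]
      field_simp
    · have h2 := pow_le_pow_left₀ (by positivity) h 2
      rw [hsq, hsq', show 2 * C * lam / η * ‖x‖ ^ 2 = C * (2 * lam / η * ‖x‖ ^ 2) by ring] at h2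
      rw [min_eq_right h, min_eq_right (le_of_mul_le_mul_right h2 hK), mul_pow, hsq']
      field_simp
  have h1 := norm_sq_clippedStep (C := C) (η := η) (lam := lam) hf hx hd
  rw [hN] at h1
  unfold scaledNorm
  rw [h1]
  ring

/-- The orthogonal gradient term can only lengthen the shrunken vector (1 - ηλ)x, so
differentiability and scale invariance stay available along the whole trajectory. -/
lemma clippedStep_ne_zero (hf : ScaleInvariant f) (hx : x ≠ 0) (hd : DifferentiableAt ℝ f x)
    (h1 : η * lam < 1) : clippedStep C η lam f x ≠ 0 := by
  intro h0
  have h2 := norm_sq_clippedStep (C := C) (η := η) (lam := lam) hf hx hd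
  rw [h0, norm_zero] at h2
  have := norm_pos_iff.2 hx
  have h3 : 0 < (1 - η * lam) ^ 2 * ‖x‖ ^ 2 := by
    have : 0 < 1 - η * lam := by linarith
    positivity
  nlinarith [sq_nonneg (η * min (Real.sqrt (2 * C * lam / η) * ‖x‖) ‖gradient f x‖)]

end Geometry

/-! ### Drift of the scaled norm relative to the extreme clipped means -/

section Drift

variable {d : ℕ} {Γ : Type*} [MeasurableSpace Γ] {D : Measure Γ}
  {L : Γ → EuclideanSpace ℝ (Fin d) → ℝ} {C η lam α : ℝ} {x : EuclideanSpace ℝ (Fin d)}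

lemma measurable_step
    (hL : Measurable fun p : Γ × EuclideanSpace ℝ (Fin d) => gradient (L p.1) p.2) :
    Measurable (Function.uncurry fun x g => clippedStep C η lam (L g) x) := by
  have h1 : Measurable fun p : EuclideanSpace ℝ (Fin d) × Γ => gradient (L p.2) p.1 :=
    hL.comp measurable_swap
  unfold Function.uncurry clippedStep
  exact (measurable_fst.const_smul (1 - η * lam)).sub
    ((measurable_const.mul ((measurable_const.mul measurable_fst.norm).min h1.norm)).smul
      (h1.norm.inv.smul h1))

lemma measurable_gradient_right
    (hL : Measurable fun p : Γ × EuclideanSpace ℝ (Fin d) => gradient (L p.1) p.2)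
    (x : EuclideanSpace ℝ (Fin d)) : Measurable fun g => gradient (L g) x :=
  hL.comp (measurable_id.prodMk measurable_const)

lemma measurable_clippedRatio
    (hL : Measurable fun p : Γ × EuclideanSpace ℝ (Fin d) => gradient (L p.1) p.2)
    (x : EuclideanSpace ℝ (Fin d)) : Measurable fun g => clippedRatio C η lam (L g) x :=
  measurable_const.min (((measurable_gradient_right hL _).norm.pow_const 2).div_const _)

/-- The mean of the clipped ratio is a truncated mean of the law of the squared gradient norm. -/
lemma scaledNorm_mul_integral_clippedRatio
    (hL : Measurable fun p : Γ × EuclideanSpace ℝ (Fin d) => gradient (L p.1) p.2)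
    (hS : 0 < scaledNorm η lam x) :
    scaledNorm η lam x ^ 2 * ∫ g, clippedRatio C η lam (L g) x ∂D =
      truncMean (gradSqLaw D L (‖x‖⁻¹ • x)) (C * scaledNorm η lam x ^ 2) := by
  unfold truncMean gradSqLaw clippedRatio
  rw [integral_map ((measurable_gradient_right hL _).norm.pow_const 2).aemeasurable
    (by fun_prop), ← integral_const_mul]
  congr 1
  funext g
  rw [mul_min_of_nonneg _ _ (by positivity), min_comm]
  congr 1
  · field_simp
  · ring

lemma gradSqLaw_nonneg
    (hL : Measurable fun p : Γ × EuclideanSpace ℝ (Fin d) => gradient (L p.1) p.2)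
    (x : EuclideanSpace ℝ (Fin d)) : ∀ᵐ t ∂(gradSqLaw D L x), 0 ≤ t := by
  unfold gradSqLaw
  rw [ae_map_iff ((measurable_gradient_right hL _).norm.pow_const 2).aemeasurable
    measurableSet_Ici]
  exact Filter.Eventually.of_forall fun g => by positivity

lemma isProbabilityMeasure_gradSqLaw [IsProbabilityMeasure D]
    (hL : Measurable fun p : Γ × EuclideanSpace ℝ (Fin d) => gradient (L p.1) p.2) :
    IsProbabilityMeasure (gradSqLaw D L x) :=
  Measure.isProbabilityMeasure_map ((measurable_gradient_right hL _).norm.pow_const 2).aemeasurable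

variable {μmin μmax : ℝ}

/-- Mean of the clipped ratio relative to `μmax`. -/
lemma upper_drift [IsProbabilityMeasure D]
    (hL : Measurable fun p : Γ × EuclideanSpace ℝ (Fin d) => gradient (L p.1) p.2)
    (hC : 1 < C) (hη : 0 < η) (hlam : 0 < lam) (hα : 0 < α) (hconc : Concentrated D L C α)
    (hmin : IsLeast (sphereClippedMeans D L C) μmin)
    (hmax : IsGreatest (sphereClippedMeans D L C) μmax) (hμ : 0 < μmin) (hx : x ≠ 0) :
    (1 ≤ scaledNorm η lam x ^ 2 / μmax →
      scaledNorm η lam x ^ 2 / μmax * ∫ g, clippedRatio C η lam (L g) x ∂D ≤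
        scaledNorm η lam x ^ 2 / μmax - α * (scaledNorm η lam x ^ 2 / μmax - 1)) ∧
    (scaledNorm η lam x ^ 2 / μmax ≤ 1 →
      scaledNorm η lam x ^ 2 / μmax * ∫ g, clippedRatio C η lam (L g) x ∂D ≤ 1) := by
  have hS := scaledNorm_pos hη hlam hx
  have hunit : ‖‖x‖⁻¹ • x‖ = 1 := norm_smul_inv_norm (𝕜 := ℝ) hx
  have hmem : clippedMean (gradSqLaw D L (‖x‖⁻¹ • x)) C ∈ sphereClippedMeans D L C :=
    ⟨_, hunit, rfl⟩
  have hpr : IsProbabilityMeasure (gradSqLaw D L (‖x‖⁻¹ • x)) := isProbabilityMeasure_gradSqLaw hL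
  have hmax0 : 0 < μmax := hμ.trans_le (hmax.2 hmin.1)
  obtain ⟨h1, h2⟩ := truncMean_le_of_clippedMean_le (gradSqLaw_nonneg hL _) hC hα
    (hμ.trans_le (hmin.2 hmem)) (hconc _ (fun h0 => by simp [h0] at hunit)) (hmax.2 hmem)
    (s := scaledNorm η lam x ^ 2)
  rw [← scaledNorm_mul_integral_clippedRatio hL hS] at h1 h2
  set S := scaledNorm η lam x ^ 2
  set e := ∫ g, clippedRatio C η lam (L g) x ∂D
  rw [le_div_iff₀ hmax0, div_le_iff₀ hmax0, one_mul]
  refine ⟨fun h => ?_, fun h => ?_⟩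
  · have := div_le_div_of_nonneg_right (h1 h) hmax0.le
    have e1 : (S - α * (S - μmax)) / μmax = S / μmax - α * (S / μmax - 1) := by field_simp
    rw [e1] at this
    rwa [div_mul_eq_mul_div]
  · rw [div_mul_eq_mul_div, div_le_one hmax0]
    exact h2 h

/-- Mean of the clipped ratio relative to `μmin`. -/
lemma lower_drift [IsProbabilityMeasure D]
    (hL : Measurable fun p : Γ × EuclideanSpace ℝ (Fin d) => gradient (L p.1) p.2)
    (hC : 1 < C) (hη : 0 < η) (hlam : 0 < lam) (hα : 0 < α) (hconc : Concentrated D L C α)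
    (hmin : IsLeast (sphereClippedMeans D L C) μmin) (hμ : 0 < μmin) (hx : x ≠ 0) :
    (scaledNorm η lam x ^ 2 / μmin ≤ 1 →
      scaledNorm η lam x ^ 2 / μmin +
        α * min (1 - scaledNorm η lam x ^ 2 / μmin) (scaledNorm η lam x ^ 2 / μmin) ≤
      scaledNorm η lam x ^ 2 / μmin * ∫ g, clippedRatio C η lam (L g) x ∂D) ∧
    (1 ≤ scaledNorm η lam x ^ 2 / μmin →
      1 ≤ scaledNorm η lam x ^ 2 / μmin * ∫ g, clippedRatio C η lam (L g) x ∂D) := by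
  have hS := scaledNorm_pos hη hlam hx
  have hunit : ‖‖x‖⁻¹ • x‖ = 1 := norm_smul_inv_norm (𝕜 := ℝ) hx
  have hmem : clippedMean (gradSqLaw D L (‖x‖⁻¹ • x)) C ∈ sphereClippedMeans D L C :=
    ⟨_, hunit, rfl⟩
  have hpr : IsProbabilityMeasure (gradSqLaw D L (‖x‖⁻¹ • x)) := isProbabilityMeasure_gradSqLaw hL
  obtain ⟨h1, h2⟩ := le_truncMean_of_le_clippedMean (gradSqLaw_nonneg hL _) hC hα
    (hμ.trans_le (hmin.2 hmem)) (hconc _ (fun h0 => by simp [h0] at hunit)) (hmin.2 hmem)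
    (s := scaledNorm η lam x ^ 2) (by positivity)
  rw [← scaledNorm_mul_integral_clippedRatio hL hS] at h1 h2
  set S := scaledNorm η lam x ^ 2
  set e := ∫ g, clippedRatio C η lam (L g) x ∂D
  rw [le_div_iff₀ hμ, div_le_iff₀ hμ, one_mul]
  refine ⟨fun h => ?_, fun h => ?_⟩
  · have := div_le_div_of_nonneg_right (h1 h) hμ.le
    have e1 : (S + α * min (μmin - S) S) / μmin = S / μmin + α * min (1 - S / μmin) (S / μmin) := by
      rw [add_div, mul_div_assoc, ← min_div_div_right hμ.le, sub_div, div_self hμ.ne']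
    rw [e1] at this
    rwa [div_mul_eq_mul_div]
  · rw [div_mul_eq_mul_div, le_div_iff₀ hμ, one_mul]
    exact h2 h

/-- The concentration constant is at most one. -/
lemma Concentrated.le_one [IsProbabilityMeasure D]
    (hL : Measurable fun p : Γ × EuclideanSpace ℝ (Fin d) => gradient (L p.1) p.2)
    (hC : 1 < C) (hα : 0 < α) (hconc : Concentrated D L C α)
    (hmin : IsLeast (sphereClippedMeans D L C) μmin) (hμ : 0 < μmin) (hx : x ≠ 0) : α ≤ 1 := by
  have hunit : ‖‖x‖⁻¹ • x‖ = 1 := norm_smul_inv_norm (𝕜 := ℝ) hx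
  have hpr : IsProbabilityMeasure (gradSqLaw D L (‖x‖⁻¹ • x)) := isProbabilityMeasure_gradSqLaw hL
  exact (truncMean_drift (gradSqLaw_nonneg hL _) hC hα
    (hμ.trans_le (hmin.2 ⟨_, hunit, rfl⟩)) (hconc _ (fun h0 => by simp [h0] at hunit))).1

end Drift

/-! ### Contraction factor and entrance time -/

lemma le_exp_neg_of_betaL {h α β : ℝ} (hh : 0 < h) (hα : 0 < α) (hα1 : α ≤ 1)
    (hh1 : h ≤ 1 / 1000)
    (hβ : β = 1 - 2 * h ^ 2 + h ^ 4 - 4 * h * α * (1 - h) ^ 2) :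
    0 < β ∧ 2 * h * α ≤ 1 - β ∧ β ≤ Real.exp (-(2 * h * α)) := by
  have h2 : h ^ 2 ≤ 1 / 1000 * h := by nlinarith
  have h4 : h ^ 4 ≤ h ^ 2 := pow_le_pow_of_le_one hh.le (by linarith) (by norm_num)
  have h40 : 0 ≤ h ^ 4 := by positivity
  have hq : 1 / 2 ≤ (1 - h) ^ 2 := by nlinarith
  have hq1 : (1 - h) ^ 2 ≤ 1 := by nlinarith
  have hhα : 0 < h * α := by positivity
  have hhα1 : h * α ≤ 1 / 1000 := by nlinarith
  have k1 : h * α * (1 / 2) ≤ h * α * (1 - h) ^ 2 := mul_le_mul_of_nonneg_left hq hhα.le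
  have k2 : h * α * (1 - h) ^ 2 ≤ h * α * 1 := mul_le_mul_of_nonneg_left hq1 hhα.le
  have h3 : 2 * h * α ≤ 1 - β := by rw [hβ]; linarith [sq_nonneg h]
  refine ⟨by rw [hβ]; linarith, h3, ?_⟩
  have := Real.add_one_le_exp (-(2 * h * α))
  linarith

/-- After the logarithmic entrance time, the contraction has gained a constant factor. -/
lemma exists_entrance_time {h α β v₀ T' : ℝ} (hβ0 : 0 < β) (hhα : 0 < h * α) (hhα1 : h * α ≤ 1)
    (hβe : β ≤ Real.exp (-(2 * h * α))) (h0 : 0 < v₀) (hT' : (v₀ + 4) / (α * h) ≤ T') :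
    ∃ n₁ : ℕ, v₀ ≤ n₁ * (h * α) ∧
      ∀ t : ℕ, T' ≤ t → n₁ ≤ t ∧ 8 * β ^ (t - n₁) ≤ β ^ ((t : ℝ) - T') / 4 := by
  have hlow := Nat.le_ceil (v₀ / (h * α))
  have hup := Nat.ceil_lt_add_one (div_pos h0 hhα).le
  set n₁ := ⌈v₀ / (h * α)⌉₊
  rw [div_le_iff₀ hhα] at hlow
  refine ⟨n₁, hlow, fun t ht => ?_⟩
  have h1 : v₀ + 4 ≤ T' * (h * α) := by
    rw [div_le_iff₀ (by rwa [mul_comm])] at hT'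
    linarith
  have h2 : n₁ * (h * α) ≤ v₀ + h * α := by
    have := mul_le_mul_of_nonneg_right hup.le hhα.le
    rwa [add_mul, div_mul_cancel₀ _ hhα.ne', one_mul] at this
  -- Of the 4 in T', at most 1 is lost to rounding up `n₁`. The remaining 3 gives β^(T' - n₁) ≤
  -- exp(-6) ≤ 1/64, which reduces a starting level of 8 to below 1/4.
  have h3 : 3 ≤ (T' - n₁) * (h * α) := by linarith
  have h4 : 0 < T' - n₁ := by
    by_contra hneg
    push Not at hneg
    nlinarith
  have h5 : n₁ ≤ t := by
    have : (n₁ : ℝ) ≤ t := by linarith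
    exact_mod_cast this
  refine ⟨h5, ?_⟩
  have h6 : β ^ (t - n₁) = β ^ ((t : ℝ) - T') * β ^ (T' - n₁) := by
    rw [← Real.rpow_add hβ0, ← Real.rpow_natCast, Nat.cast_sub h5]
    congr 1
    ring
  have h7 : β ^ (T' - n₁) ≤ 1 / 64 := by
    calc β ^ (T' - n₁) ≤ Real.exp (-(2 * h * α)) ^ (T' - n₁) :=
          Real.rpow_le_rpow hβ0.le hβe h4.le
      _ = Real.exp (-(2 * h * α) * (T' - n₁)) := (Real.exp_mul _ _).symm
      _ ≤ Real.exp (-6) := Real.exp_le_exp.2 (by linarith)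
      _ ≤ 1 / 64 := by
        rw [Real.exp_neg, one_div]
        refine inv_anti₀ (by norm_num) ?_
        have e1 : (2 : ℝ) ≤ Real.exp 1 := by linarith [Real.add_one_le_exp (1 : ℝ)]
        have e2 : Real.exp 6 = Real.exp 1 ^ 6 := by rw [← Real.exp_nat_mul]; norm_num
        rw [e2]
        calc (64 : ℝ) = 2 ^ 6 := by norm_num
          _ ≤ _ := pow_le_pow_left₀ (by norm_num) e1 6
  rw [h6]
  have h8 := Real.rpow_nonneg hβ0.le ((t : ℝ) - T')
  calc 8 * (β ^ ((t : ℝ) - T') * β ^ (T' - n₁))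
      = 8 * β ^ ((t : ℝ) - T') * β ^ (T' - n₁) := by ring
    _ ≤ 8 * β ^ ((t : ℝ) - T') * (1 / 64) := mul_le_mul_of_nonneg_left h7 (by positivity)
    _ ≤ _ := by linarith

/-! ### Tail bounds for one side of the stationary level -/

section Side

variable {E Γ Ω : Type*} [MeasurableSpace E] [MeasurableSpace Γ] [MeasurableSpace Ω]
  {D : Measure Γ} {P : Measure Ω} [IsProbabilityMeasure P] [IsProbabilityMeasure D]
  {step : E → Γ → E} {X : ℕ → Ω → E} {x₀ : E} {good : E → Prop}

set_option maxHeartbeats 800000 in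
/-- Tail bound at a single time for one side of the stationary level. -/
theorem IsChain.pointwise_tail_le (hX : IsChain D P step X x₀ good) {v W : E → ℝ}
    (hv : Measurable v) (hW : Measurable W) {h C α β b l₁ l₂ ℓ s : ℝ} {T : ℕ}
    (hh : 0 < h) (hC : 1 < C) (hα : 0 < α) (hα1 : α ≤ 1)
    (hβ : β = 1 - 2 * h ^ 2 + h ^ 4 - 4 * h * α * (1 - h) ^ 2)
    (hT : 1 ≤ T) (hℓ : 1 ≤ ℓ) (hTℓ : 9 * T ≤ Real.exp ℓ)
    (hs : 0 < s) (hs1 : s ≤ 1 / 100000) (hsℓ : s ^ 2 * α = ℓ * (h * C))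
    (hdrift : ∀ k, 0 ≤ k → k * h * C ≤ α / 64 → ∀ x, good x →
      ∫⁻ g, ENNReal.ofReal (Real.exp (k * v (step x g))) ∂D ≤
        ENNReal.ofReal (Real.exp (-(k * h * α)) * Real.exp (k * v x) + Real.exp (k * l₁)))
    (hl₁ : 0 ≤ l₁) (hl₂ : l₁ + 1 / 6 ≤ l₂) (hvW : ∀ x, good x → b < W x → l₂ ≤ v x)
    (hb : 0 ≤ b) (hb8 : b ≤ 8)
    (hone : ∀ θ, 0 ≤ θ → θ * h * C ≤ 1 / 1000 → ∀ x, good x → W x ≤ b →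
      ∫⁻ g, ENNReal.ofReal (Real.exp (θ * W (step x g))) ∂D ≤
        ENNReal.ofReal (Real.exp (36 * h ^ 2 * C * θ + 5184 * h ^ 2 * C * θ ^ 2) *
          (1 + Real.exp (β * θ * W x))))
    {n₁ t : ℕ} {D₀ : ℝ} (hD₀ : 0 ≤ D₀) (hn₁ : v x₀ ≤ n₁ * (h * α))
    (hbase : ∀ ω, W (X n₁ ω) ≤ b → W (X n₁ ω) ≤ D₀) (ht₁ : n₁ ≤ t) (htT : t ≤ T) :
    P.real {ω | D₀ * β ^ (t - n₁) + 3000 * s < W (X t ω)} ≤ 2 * Real.exp (-(4 * ℓ)) := by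
  have hhC : 0 < h * C := by positivity
  have hs2 : s ^ 2 ≤ 1 / 10 ^ 10 := by
    have := pow_le_pow_left₀ hs.le hs1 2
    norm_num at this ⊢
    exact this
  have hhCα : h * C ≤ α / 10 ^ 10 := by nlinarith
  have hh1 : h ≤ 1 / 1000 := by nlinarith
  obtain ⟨hβ0, hβ2, hβe⟩ := le_exp_neg_of_betaL hh hα hα1 hh1 hβ
  have hhα : 0 < h * α := by positivity
  have hhα1 : h * α ≤ 1 := by nlinarith
  have hβ1 : β ≤ 1 := by linarith
  -- `Q` is the inverse variance scale. The Lyapunov exponent is k = Q/64, the largest that `hdrift`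
  -- admits; the Chernoff parameter θ = sQ satisfies θs = ℓ and is far smaller than `Q`.
  obtain ⟨Q, hQdef⟩ : ∃ Q, Q = α / (h * C) := ⟨_, rfl⟩
  have hQ0 : 0 < Q := by rw [hQdef]; positivity
  have hQ : Q * (h * C) = α := by rw [hQdef]; field_simp
  have hsQ : s ^ 2 * Q = ℓ := by
    have : (s ^ 2 * Q) * (h * C) = ℓ * (h * C) := by rw [mul_assoc, hQ, hsℓ]
    exact mul_right_cancel₀ hhC.ne' this
  obtain ⟨θ, hθdef⟩ : ∃ θ, θ = s * Q := ⟨_, rfl⟩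
  have hθ0 : 0 < θ := by rw [hθdef]; positivity
  have hT0 : (1 : ℝ) ≤ T := by exact_mod_cast hT
  have hℓQ : ℓ ≤ Q / 10 ^ 10 := by rw [← hsQ]; nlinarith
  have hθQ : θ ≤ Q / 100000 := by rw [hθdef]; nlinarith
  have hθhC : θ * (h * C) = s * α := by rw [hθdef, mul_assoc, hQ]
  -- The rate is Q/384 = (Q/64)(1/6): the gap 1/6 between the levels `l₁` and `l₂`, magnified by the
  -- exponent k.
  obtain ⟨p, hpdef⟩ : ∃ p, p = 2 * T * Real.exp (-(Q / 384)) := ⟨_, rfl⟩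
  have hTe : 2 * (T : ℝ) ≤ Real.exp ℓ := by linarith
  have hpe : p ≤ Real.exp (ℓ - Q / 384) := by
    rw [hpdef, sub_eq_add_neg, Real.exp_add]
    exact mul_le_mul_of_nonneg_right hTe (Real.exp_pos _).le
  have hk0 : 0 ≤ Q / 64 := by positivity
  have hkhC : Q / 64 * h * C ≤ α / 64 := by
    have : Q / 64 * h * C = α / 64 := by rw [← hQ]; ring
    exact this.le
  have hmain := hX.tail_le (V := fun x => Real.exp (Q / 64 * v x)) (W := W)
    (hv.const_mul _).exp hW (fun x => (Real.exp_pos _).le)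
    (ρ := Real.exp (-(Q / 64 * h * α))) (A := Real.exp (Q / 64 * l₁))
    (v₀ := Real.exp (Q / 64 * l₂)) (b := b) (β := β) (D₁ := 36 * h ^ 2 * C)
    (D₂ := 5184 * h ^ 2 * C) (d₁ := 18 * (h * C) / α) (d₂ := 2592 * (h * C) / α) (p := p)
    (θ := θ) (D₀ := D₀) (z := 3000 * s) (n₁ := n₁) (T := T)
    (Real.exp_pos _).le (Real.exp_le_one_iff.2 (by
      have : 0 ≤ Q / 64 * h * α := by positivity
      linarith)) (Real.exp_pos _).le (Real.exp_pos _)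
    (hdrift _ hk0 hkhC)
    (fun x hx hbx => Real.exp_le_exp.2 (mul_le_mul_of_nonneg_left (hvW x hx hbx) hk0))
    (by
      rw [← Real.exp_nat_mul, ← Real.exp_add]
      refine Real.exp_le_one_iff.2 ?_
      have := mul_le_mul_of_nonneg_left hn₁ hk0
      linarith)
    (by
      have e1 : Real.exp (Q / 64 * l₁) * Real.exp (Q / 384) ≤ Real.exp (Q / 64 * l₂) := by
        rw [← Real.exp_add]
        refine Real.exp_le_exp.2 ?_
        have := mul_le_mul_of_nonneg_left hl₂ hk0
        linarith
      have e2 : 1 ≤ Real.exp (Q / 64 * l₁) := Real.one_le_exp (by positivity)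
      have e3 : Real.exp (-(Q / 384)) * Real.exp (Q / 384) = 1 := by
        rw [← Real.exp_add]; simp
      have e4 : Real.exp (Q / 64 * l₁) ≤ Real.exp (-(Q / 384)) * Real.exp (Q / 64 * l₂) := by
        have := mul_le_mul_of_nonneg_left e1 (Real.exp_pos (-(Q / 384))).le
        rw [mul_left_comm, e3, mul_one] at this
        exact this
      have e5 := mul_le_mul_of_nonneg_left e4 (by linarith : (0 : ℝ) ≤ 2 * T)
      rw [hpdef]
      nlinarith)
    hb hβ0.le hβ1 (by positivity) (by positivity) (by positivity) (by positivity)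
    (by
      have := mul_le_mul_of_nonneg_right hβ2
        (show 0 ≤ 18 * (h * C) / α by positivity)
      refine le_trans (le_of_eq ?_) this
      field_simp
      ring)
    (by
      have := mul_le_mul_of_nonneg_right hβ2
        (show 0 ≤ 2592 * (h * C) / α by positivity)
      refine le_trans (le_of_eq ?_) this
      field_simp
      ring)
    hθ0.le
    (by
      -- The exponent is at most 8θ + ℓ - Q/384, and both θ ≤ Q/10⁵ and ℓ ≤ Q/10¹⁰ are negligible
      -- against Q/384.
      refine (mul_le_mul_of_nonneg_left hpe (Real.exp_pos _).le).trans ?_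
      rw [← Real.exp_add]
      refine Real.exp_le_one_iff.2 ?_
      have := mul_le_mul_of_nonneg_left hb8 hθ0.le
      linarith)
    (fun θ' h0 h1 x hx hbx => hone θ' h0 (by
      have := mul_le_mul_of_nonneg_right h1 hhC.le
      rw [hθhC] at this
      nlinarith) x hx hbx)
    hbase hD₀ ht₁ htT
  refine hmain.trans ?_
  have g1 : p ≤ Real.exp (-(4 * ℓ)) := hpe.trans (Real.exp_le_exp.2 (by linarith))
  have g2 : 18 * (h * C) / α * θ + 2592 * (h * C) / α * θ ^ 2 = 18 * s + 2592 * ℓ := by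
    have : (h * C) / α * θ = s := by
      rw [div_mul_eq_mul_div, mul_comm, hθhC]; field_simp
    calc _ = 18 * ((h * C) / α * θ) + 2592 * (((h * C) / α * θ) * θ) := by ring
      _ = _ := by rw [this, ← hsQ, hθdef]; ring
  have g3 : θ * (3000 * s) = 3000 * ℓ := by rw [hθdef, ← hsQ]; ring
  -- The constant 3000 outweighs the variance term 2592ℓ, the ℓ from the factor 2T + 1, the small
  -- 18s and the required 4ℓ.
  have g4 : Real.exp (18 * (h * C) / α * θ + 2592 * (h * C) / α * θ ^ 2) * (2 * T + 1) *
      Real.exp (-(θ * (3000 * s))) ≤ Real.exp (-(4 * ℓ)) := by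
    rw [g2, g3]
    calc _ ≤ Real.exp (18 * s + 2592 * ℓ) * Real.exp ℓ * Real.exp (-(3000 * ℓ)) := by
          gcongr
          linarith
      _ = Real.exp (18 * s + 2592 * ℓ + ℓ + -(3000 * ℓ)) := by
          rw [← Real.exp_add, ← Real.exp_add]
      _ ≤ _ := Real.exp_le_exp.2 (by linarith)
  linarith

/-- Uniform tail bound for one side of the stationary level. -/
theorem IsChain.uniform_tail_le (hX : IsChain D P step X x₀ good) {v W : E → ℝ}
    (hv : Measurable v) (hW : Measurable W) {h C α β b l₁ l₂ ℓ s δ T' : ℝ} {T : ℕ}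
    (hh : 0 < h) (hC : 1 < C) (hα : 0 < α) (hα1 : α ≤ 1)
    (hβ : β = 1 - 2 * h ^ 2 + h ^ 4 - 4 * h * α * (1 - h) ^ 2)
    (hT : 1 ≤ T) (hℓ : 1 ≤ ℓ) (hTℓ : 9 * T ≤ Real.exp ℓ) (hδ : Real.exp (-ℓ) ≤ δ)
    (hs : 0 < s) (hs1 : s ≤ 1 / 100000) (hsℓ : s ^ 2 * α = ℓ * (h * C))
    (hdrift : ∀ k, 0 ≤ k → k * h * C ≤ α / 64 → ∀ x, good x →
      ∫⁻ g, ENNReal.ofReal (Real.exp (k * v (step x g))) ∂D ≤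
        ENNReal.ofReal (Real.exp (-(k * h * α)) * Real.exp (k * v x) + Real.exp (k * l₁)))
    (hl₁ : 0 ≤ l₁) (hl₂ : l₁ + 1 / 6 ≤ l₂) (hvW : ∀ x, good x → b < W x → l₂ ≤ v x)
    (hb : 0 ≤ b) (hb8 : b ≤ 8)
    (hone : ∀ θ, 0 ≤ θ → θ * h * C ≤ 1 / 1000 → ∀ x, good x → W x ≤ b →
      ∫⁻ g, ENNReal.ofReal (Real.exp (θ * W (step x g))) ∂D ≤
        ENNReal.ofReal (Real.exp (36 * h ^ 2 * C * θ + 5184 * h ^ 2 * C * θ ^ 2) *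
          (1 + Real.exp (β * θ * W x))))
    (hx₀ : v x₀ ≤ 0 → W x₀ ≤ 0) (hT' : (v x₀ + 4) / (α * h) ≤ T') :
    P.real {ω | ∃ t : ℕ, T' ≤ (t : ℝ) ∧ t ≤ T ∧
      β ^ ((t : ℝ) - T') / 4 + 3000 * s < W (X t ω)} ≤ δ := by
  have hhC : 0 < h * C := by positivity
  have hs2 : s ^ 2 ≤ 1 / 10 ^ 10 := by
    have := pow_le_pow_left₀ hs.le hs1 2
    norm_num at this ⊢
    exact this
  have hhCα : h * C ≤ α / 10 ^ 10 := by nlinarith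
  have hh1 : h ≤ 1 / 1000 := by nlinarith
  obtain ⟨hβ0, hβ2, hβe⟩ := le_exp_neg_of_betaL hh hα hα1 hh1 hβ
  have hhα : 0 < h * α := by positivity
  have hhα1 : h * α ≤ 1 := by nlinarith
  have hβ1 : β ≤ 1 := by linarith
  -- the entrance time and level
  obtain ⟨n₁, D₀, hD₀, hn₁, hbase, hdecay⟩ : ∃ (n₁ : ℕ) (D₀ : ℝ), 0 ≤ D₀ ∧
      v x₀ ≤ n₁ * (h * α) ∧ (∀ ω, W (X n₁ ω) ≤ b → W (X n₁ ω) ≤ D₀) ∧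
      ∀ t : ℕ, T' ≤ t → n₁ ≤ t ∧ D₀ * β ^ (t - n₁) ≤ β ^ ((t : ℝ) - T') / 4 := by
    -- A start on the right side of the level needs no entrance time and has excess at most 0.
    -- Otherwise the only level known at time `n₁` is the window bound `b` ≤ 8.
    rcases le_or_gt (v x₀) 0 with h0 | h0
    · refine ⟨0, 0, le_rfl, by simpa using h0, fun ω _ => ?_, fun t _ => ⟨Nat.zero_le _, ?_⟩⟩
      · rw [hX.start]; exact hx₀ h0
      · rw [zero_mul]
        have := Real.rpow_nonneg hβ0.le ((t : ℝ) - T')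
        linarith
    · obtain ⟨n₁, hlow, hdec⟩ := exists_entrance_time hβ0 hhα hhα1 hβe h0 hT'
      refine ⟨n₁, b, hb, hlow, fun ω hω => hω, fun t ht => ⟨(hdec t ht).1, ?_⟩⟩
      exact (mul_le_mul_of_nonneg_right hb8 (by positivity)).trans (hdec t ht).2
  have hT0 : (1 : ℝ) ≤ T := by exact_mod_cast hT
  have htail : ∀ t : ℕ, T' ≤ t → t ≤ T →
      P.real {ω | β ^ ((t : ℝ) - T') / 4 + 3000 * s < W (X t ω)} ≤ 2 * Real.exp (-(4 * ℓ)) := by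
    intro t ht htT
    obtain ⟨h5, h6⟩ := hdecay t ht
    have hsub : {ω | β ^ ((t : ℝ) - T') / 4 + 3000 * s < W (X t ω)} ⊆
        {ω | D₀ * β ^ (t - n₁) + 3000 * s < W (X t ω)} := fun ω hω =>
      lt_of_le_of_lt (add_le_add_left h6 _) hω
    exact (measureReal_mono hsub).trans
      (hX.pointwise_tail_le hv hW hh hC hα hα1 hβ hT hℓ hTℓ hs hs1 hsℓ hdrift hl₁ hl₂ hvW hb hb8
        hone hD₀ hn₁ hbase h5 htT)
  have hsub : {ω | ∃ t : ℕ, T' ≤ (t : ℝ) ∧ t ≤ T ∧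
      β ^ ((t : ℝ) - T') / 4 + 3000 * s < W (X t ω)} ⊆
      ⋃ t ∈ Finset.range (T + 1), {ω | T' ≤ (t : ℝ) ∧ t ≤ T ∧
        β ^ ((t : ℝ) - T') / 4 + 3000 * s < W (X t ω)} := fun ω ⟨t, h1, h2, h3⟩ =>
    Set.mem_biUnion (Finset.mem_coe.2 (Finset.mem_range.2 (Nat.lt_succ_of_le h2))) ⟨h1, h2, h3⟩
  have hterm : ∀ t ∈ Finset.range (T + 1), P.real {ω | T' ≤ (t : ℝ) ∧ t ≤ T ∧
        β ^ ((t : ℝ) - T') / 4 + 3000 * s < W (X t ω)} ≤ 2 * Real.exp (-(4 * ℓ)) := by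
    intro t ht
    by_cases h1 : T' ≤ (t : ℝ)
    · exact (measureReal_mono fun ω hω => hω.2.2).trans
        (htail t h1 (Nat.lt_succ_iff.1 (Finset.mem_range.1 ht)))
    · simp only [h1, false_and]
      simpa using (Real.exp_pos _).le
  calc _ ≤ ∑ t ∈ Finset.range (T + 1), P.real {ω | T' ≤ (t : ℝ) ∧ t ≤ T ∧
        β ^ ((t : ℝ) - T') / 4 + 3000 * s < W (X t ω)} :=
        (measureReal_mono hsub (measure_ne_top _ _)).trans (measureReal_biUnion_finset_le _ _)
    _ ≤ ∑ _t ∈ Finset.range (T + 1), 2 * Real.exp (-(4 * ℓ)) := Finset.sum_le_sum hterm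
    _ = 2 * (T + 1) * Real.exp (-(4 * ℓ)) := by
        rw [Finset.sum_const, Finset.card_range, nsmul_eq_mul]; push_cast; ring
    -- The count of times is absorbed by 2(T + 1) ≤ 9T ≤ exp ℓ.
    _ ≤ Real.exp ℓ * Real.exp (-(4 * ℓ)) := by gcongr; linarith
    _ ≤ Real.exp (-ℓ) := by rw [← Real.exp_add]; exact Real.exp_le_exp.2 (by linarith)
    _ ≤ δ := hδ

end Side

/-! ### The two tails for clipped SGD -/

section Main

variable {d : ℕ} {Γ Ω : Type*} [MeasurableSpace Γ] [MeasurableSpace Ω] {D : Measure Γ}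
  [IsProbabilityMeasure D] {P : Measure Ω} [IsProbabilityMeasure P]
  {L : Γ → EuclideanSpace ℝ (Fin d) → ℝ} {γ : ℕ → Ω → Γ}
  {C η lam α μmin μmax ℓ s δ T' : ℝ} {x₀ : EuclideanSpace ℝ (Fin d)} {T : ℕ}

lemma measurable_scaledNorm : Measurable (scaledNorm (d := d) η lam) := by
  unfold scaledNorm
  fun_prop

omit [IsProbabilityMeasure D] in
/-- The iterates of clipped SGD form a chain that avoids the origin. -/
lemma isChain_iterate (hsi : ∀ g, ScaleInvariant (L g))
    (hdiff : ∀ g, ∀ x, x ≠ 0 → DifferentiableAt ℝ (L g) x)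
    (hL : Measurable (fun p : Γ × EuclideanSpace ℝ (Fin d) => gradient (L p.1) p.2))
    (hγ : ∀ t, Measurable (γ t)) (hD : ∀ t, P.map (γ t) = D) (hind : iIndepFun γ P)
    (h1 : η * lam < 1) (hx₀ : x₀ ≠ 0) :
    IsChain D P (fun x g => clippedStep C η lam (L g) x)
      (fun t ω => iterate C η lam x₀ (fun s => L (γ s ω)) t) x₀ (fun x => x ≠ 0) where
  start _ := rfl
  good t ω := by
    induction t with
    | zero => exact hx₀
    | succ t ih => exact clippedStep_ne_zero (hsi _) ih (hdiff _ _ ih) h1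
  meas := chain_measurable hγ (measurable_step hL) (fun _ => rfl) fun _ _ => rfl
  lintegral_succ t _ hf := chain_lintegral_succ (X := fun t ω =>
    iterate C η lam x₀ (fun s => L (γ s ω)) t) hγ hD hind (measurable_step hL) (fun _ => rfl)
    (fun _ _ => rfl) t hf

/-- On the upper side, 3 is the level reachable from y ≤ 2 in one step and 9 is the edge of the
window; the gap is what makes leaving the window exponentially unlikely. -/
lemma log_three_add_le : Real.log 3 + 1 / 6 ≤ Real.log 9 := by
  rw [show (9 : ℝ) = 3 ^ 2 by norm_num, Real.log_pow]
  have := Real.one_sub_inv_le_log_of_pos (show (0 : ℝ) < 3 by norm_num)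
  push_cast
  linarith

/-- The same gap for 1/y: one step from y ≥ 2/3 keeps 1/y below 5/3, and the window ends at 1/y = 2.
-/
lemma log_five_thirds_add_le : Real.log (5 / 3) + 1 / 6 ≤ Real.log 2 := by
  have h1 : Real.log 2 = Real.log (5 / 3) + Real.log (6 / 5) := by
    rw [← Real.log_mul (by norm_num) (by norm_num)]; norm_num
  have := Real.one_sub_inv_le_log_of_pos (show (0 : ℝ) < 6 / 5 by norm_num)
  rw [h1]
  norm_num at this
  linarith

/-- Upper tail of the scaled norm, uniformly in time. -/
lemma upper_tail (hsi : ∀ g, ScaleInvariant (L g))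
    (hdiff : ∀ g, ∀ x, x ≠ 0 → DifferentiableAt ℝ (L g) x)
    (hL : Measurable (fun p : Γ × EuclideanSpace ℝ (Fin d) => gradient (L p.1) p.2))
    (hγ : ∀ t, Measurable (γ t)) (hD : ∀ t, P.map (γ t) = D) (hind : iIndepFun γ P)
    (hC : 1 < C) (hη : 0 < η) (hlam : 0 < lam) (hT : 1 ≤ T) (hx₀ : x₀ ≠ 0)
    (hα : 0 < α) (hconc : Concentrated D L C α)
    (hmin : IsLeast (sphereClippedMeans D L C) μmin)
    (hmax : IsGreatest (sphereClippedMeans D L C) μmax) (hμ : 0 < μmin)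
    (hℓ : 1 ≤ ℓ) (hTℓ : 9 * T ≤ Real.exp ℓ) (hδ : Real.exp (-ℓ) ≤ δ)
    (hs : 0 < s) (hs1 : s ≤ 1 / 100000) (hsℓ : s ^ 2 * α = ℓ * (η * lam * C))
    (hhC : η * lam * C ≤ α / 1000)
    (hT' : (Real.log (scaledNorm η lam x₀ ^ 2 / μmax) + 4) / (α * (η * lam)) ≤ T') :
    P.real {ω | ∃ t : ℕ, T' ≤ (t : ℝ) ∧ t ≤ T ∧
      betaL η lam α ^ ((t : ℝ) - T') / 4 + 3000 * s <
        scaledNorm η lam (iterate C η lam x₀ (fun s => L (γ s ω)) t) ^ 2 / μmax - 1} ≤ δ := by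
  have hh : 0 < η * lam := by positivity
  have hα1 := hconc.le_one hL hC hα hmin hμ hx₀
  have hmax0 : 0 < μmax := hμ.trans_le (hmax.2 hmin.1)
  have hβ : betaL η lam α = 1 - 2 * (η * lam) ^ 2 + (η * lam) ^ 4 -
      4 * (η * lam) * α * (1 - η * lam) ^ 2 := by unfold betaL; ring
  have hy : ∀ x : EuclideanSpace ℝ (Fin d), x ≠ 0 → 0 < scaledNorm η lam x ^ 2 / μmax :=
    fun x hx => by have := scaledNorm_pos hη hlam hx; positivity
  have hstep : ∀ (x : EuclideanSpace ℝ (Fin d)) g, x ≠ 0 →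
      scaledNorm η lam (clippedStep C η lam (L g) x) ^ 2 / μmax = scaledNorm η lam x ^ 2 / μmax *
        ((1 - η * lam) ^ 2 + 2 * (η * lam) * clippedRatio C η lam (L g) x) ^ 2 :=
    fun x g hx => by
      rw [scaledNorm_clippedStep (hsi g) hx (hdiff g x hx) (by linarith) hη hlam]; ring
  have hm := measurable_clippedRatio (C := C) (η := η) (lam := lam) hL
  have hm0 : ∀ (x : EuclideanSpace ℝ (Fin d)) g, 0 ≤ clippedRatio C η lam (L g) x :=
    fun x g => clippedRatio_nonneg (by linarith)
  have hmC : ∀ (x : EuclideanSpace ℝ (Fin d)) g, clippedRatio C η lam (L g) x ≤ C :=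
    fun x g => min_le_left _ _
  have hmeas : Measurable fun x : EuclideanSpace ℝ (Fin d) => scaledNorm η lam x ^ 2 / μmax :=
    (measurable_scaledNorm.pow_const 2).div_const _
  refine (isChain_iterate hsi hdiff hL hγ hD hind (by nlinarith) hx₀).uniform_tail_le
    (v := fun x => Real.log (scaledNorm η lam x ^ 2 / μmax))
    (W := fun x => scaledNorm η lam x ^ 2 / μmax - 1) (h := η * lam) (C := C) (b := 8)
    (l₁ := Real.log 3) (l₂ := Real.log 9)
    hmeas.log (hmeas.sub_const 1) hh hC hα hα1 hβ hT hℓ hTℓ hδ hs hs1 hsℓ ?_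
    (Real.log_nonneg (by norm_num)) log_three_add_le ?_ (by norm_num) le_rfl ?_ ?_ hT'
  · intro k hk hkhC x hx
    have := one_step_upper_moment (hm x) (hm0 x) (hmC x) hh hC hα hα1 hhC hk hkhC (hy x hx)
      (upper_drift hL hC hη hlam hα hconc hmin hmax hμ hx).1
    simpa only [hstep x _ hx] using this
  · intro x hx hb
    exact Real.log_le_log (by norm_num) (by linarith)
  · intro θ hθ hθC x hx hb
    obtain ⟨h1, h2⟩ := upper_drift (η := η) (lam := lam) hL hC hη hlam hα hconc hmin hmax hμ hx
    have := one_step_upper_exp (hm x) (hm0 x) (hmC x) hh hC hα hα1 hhC hβ hθ hθC (hy x hx)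
      (by linarith) h1 h2
    simpa only [hstep x _ hx] using this
  · intro h0
    have := (Real.log_nonpos_iff (hy x₀ hx₀).le).1 h0
    linarith

/-- Lower tail of the scaled norm, uniformly in time. -/
lemma lower_tail (hsi : ∀ g, ScaleInvariant (L g))
    (hdiff : ∀ g, ∀ x, x ≠ 0 → DifferentiableAt ℝ (L g) x)
    (hL : Measurable (fun p : Γ × EuclideanSpace ℝ (Fin d) => gradient (L p.1) p.2))
    (hγ : ∀ t, Measurable (γ t)) (hD : ∀ t, P.map (γ t) = D) (hind : iIndepFun γ P)
    (hC : 1 < C) (hη : 0 < η) (hlam : 0 < lam) (hT : 1 ≤ T) (hx₀ : x₀ ≠ 0)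
    (hα : 0 < α) (hconc : Concentrated D L C α)
    (hmin : IsLeast (sphereClippedMeans D L C) μmin) (hμ : 0 < μmin)
    (hℓ : 1 ≤ ℓ) (hTℓ : 9 * T ≤ Real.exp ℓ) (hδ : Real.exp (-ℓ) ≤ δ)
    (hs : 0 < s) (hs1 : s ≤ 1 / 100000) (hsℓ : s ^ 2 * α = ℓ * (η * lam * C))
    (hhC : η * lam * C ≤ α / 1000)
    (hT' : (Real.log (μmin / scaledNorm η lam x₀ ^ 2) + 4) / (α * (η * lam)) ≤ T') :
    P.real {ω | ∃ t : ℕ, T' ≤ (t : ℝ) ∧ t ≤ T ∧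
      betaL η lam α ^ ((t : ℝ) - T') / 4 + 3000 * s <
        1 - scaledNorm η lam (iterate C η lam x₀ (fun s => L (γ s ω)) t) ^ 2 / μmin} ≤ δ := by
  have hh : 0 < η * lam := by positivity
  have hα1 := hconc.le_one hL hC hα hmin hμ hx₀
  have hβ : betaL η lam α = 1 - 2 * (η * lam) ^ 2 + (η * lam) ^ 4 -
      4 * (η * lam) * α * (1 - η * lam) ^ 2 := by unfold betaL; ring
  have hy : ∀ x : EuclideanSpace ℝ (Fin d), x ≠ 0 → 0 < scaledNorm η lam x ^ 2 / μmin :=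
    fun x hx => by have := scaledNorm_pos hη hlam hx; positivity
  have hstep : ∀ (x : EuclideanSpace ℝ (Fin d)) g, x ≠ 0 →
      scaledNorm η lam (clippedStep C η lam (L g) x) ^ 2 / μmin = scaledNorm η lam x ^ 2 / μmin *
        ((1 - η * lam) ^ 2 + 2 * (η * lam) * clippedRatio C η lam (L g) x) ^ 2 :=
    fun x g hx => by
      rw [scaledNorm_clippedStep (hsi g) hx (hdiff g x hx) (by linarith) hη hlam]; ring
  have hm := measurable_clippedRatio (C := C) (η := η) (lam := lam) hL
  have hm0 : ∀ (x : EuclideanSpace ℝ (Fin d)) g, 0 ≤ clippedRatio C η lam (L g) x :=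
    fun x g => clippedRatio_nonneg (by linarith)
  have hmC : ∀ (x : EuclideanSpace ℝ (Fin d)) g, clippedRatio C η lam (L g) x ≤ C :=
    fun x g => min_le_left _ _
  have hmeas : Measurable fun x : EuclideanSpace ℝ (Fin d) => scaledNorm η lam x ^ 2 / μmin :=
    (measurable_scaledNorm.pow_const 2).div_const _
  refine (isChain_iterate hsi hdiff hL hγ hD hind (by nlinarith) hx₀).uniform_tail_le
    (v := fun x => -Real.log (scaledNorm η lam x ^ 2 / μmin))
    (W := fun x => 1 - scaledNorm η lam x ^ 2 / μmin) (h := η * lam) (C := C) (b := 1 / 2)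
    (l₁ := Real.log (5 / 3)) (l₂ := Real.log 2)
    hmeas.log.neg (hmeas.const_sub 1) hh hC hα hα1 hβ hT hℓ hTℓ hδ hs hs1 hsℓ ?_
    (Real.log_nonneg (by norm_num)) log_five_thirds_add_le ?_ (by norm_num) (by norm_num) ?_ ?_ ?_
  · intro k hk hkhC x hx
    have := one_step_lower_moment (hm x) (hm0 x) (hmC x) hh hC hα hα1 hhC hk hkhC (hy x hx)
      (lower_drift hL hC hη hlam hα hconc hmin hμ hx).1
    simpa only [hstep x _ hx, neg_mul, mul_neg] using this
  · intro x hx hb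
    rw [← Real.log_inv]
    refine Real.log_le_log (by norm_num) ?_
    rw [le_inv_comm₀ (by norm_num) (hy x hx)]
    linarith
  · intro θ hθ hθC x hx hb
    obtain ⟨h1, h2⟩ := lower_drift (η := η) (lam := lam) hL hC hη hlam hα hconc hmin hμ hx
    have := one_step_lower_exp (hm x) (hm0 x) (hmC x) hh hC hα hα1 hhC hβ hθ hθC
      (by linarith) h1 h2
    simpa only [hstep x _ hx] using this
  · intro h0
    have := (Real.log_nonneg_iff (hy x₀ hx₀)).1 (by linarith)
    linarith
  · rwa [← Real.log_inv, inv_div]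

end Main

end ClippedSGD

/-! ### Choice of constants and conclusion -/

theorem mainTheorem4 :
    ∃ c K₁ K₂ : ℝ, 0 < c ∧ 0 < K₁ ∧ 0 < K₂ ∧
      ∀ (d : ℕ) (Γ : Type*) [MeasurableSpace Γ] (D : Measure Γ)
        (L : Γ → EuclideanSpace ℝ (Fin d) → ℝ)
        (Ω : Type*) [MeasurableSpace Ω] (P : Measure Ω) [IsProbabilityMeasure P]
        (γ : ℕ → Ω → Γ)
        (C η lam α δ : ℝ) (T : ℕ) (x₀ : EuclideanSpace ℝ (Fin d)) (μmin μmax : ℝ),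
        -- scale invariant losses on `ℝ^d ∖ {0}`
        (∀ g, ClippedSGD.ScaleInvariant (L g)) →
        (∀ g, ∀ x, x ≠ 0 → DifferentiableAt ℝ (L g) x) →
        Measurable (fun p : Γ × EuclideanSpace ℝ (Fin d) => gradient (L p.1) p.2) →
        -- the `γ t` are i.i.d. with law `D`
        (∀ t, Measurable (γ t)) → (∀ t, P.map (γ t) = D) → iIndepFun γ P →
        1 < C → 0 < η → 0 < lam → 0 < δ → δ < 1 → 1 ≤ T → x₀ ≠ 0 →
        -- the concentration assumption
        0 < α → ClippedSGD.Concentrated D L C α →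
        IsLeast (ClippedSGD.sphereClippedMeans D L C) μmin →
        IsGreatest (ClippedSGD.sphereClippedMeans D L C) μmax →
        0 < μmin →
        η * lam ≤ c * min 1 (α / (C * Real.log (T / δ ^ 2))) →
        let R : ℕ → Ω → ℝ := fun t ω =>
          ClippedSGD.scaledNorm η lam
            (ClippedSGD.iterate C η lam x₀ (fun s => L (γ s ω)) t)
        let R₀ : ℝ := ClippedSGD.scaledNorm η lam x₀
        let T' : ℝ :=
          (max (Real.log (R₀ ^ 2 / μmax)) (Real.log (μmin / R₀ ^ 2)) + K₁) / (α * (η * lam))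
        let err : ℝ := K₂ * Real.sqrt (C / α * Real.log (T / δ ^ 2)) * Real.sqrt (η * lam)
        1 - 3 * δ ≤ P.real {ω | ∀ t : ℕ, T' ≤ (t : ℝ) → t ≤ T →
          (μmin / 2 ≤ R t ω ^ 2 ∧ R t ω ^ 2 ≤ 2 * μmax) ∧
          ((1 - ClippedSGD.betaL η lam α ^ ((t : ℝ) - T')) * μmin - err * μmin ≤ R t ω ^ 2 ∧
            R t ω ^ 2 ≤
              μmax * (1 + ClippedSGD.betaU C η lam α ^ ((t : ℝ) - T')) + err * μmax)} := by
  refine ⟨1 / 10 ^ 10, 4, 3000, by norm_num, by norm_num, by norm_num, ?_⟩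
  intro d Γ _ D L Ω _ P _ γ C η lam α δ T x₀ μmin μmax hsi hdiff hL hγ hD hind hC hη hlam hδ0 hδ1
    hT hx₀ hα hconc hmin hmax hμ hsmall R R₀ T' err
  -- For δ ≥ 1/3 the claimed probability is nonpositive. For δ < 1/3 the logarithm ℓ = ln(T/δ²)
  -- satisfies ℓ ≥ 1 and 9T ≤ exp ℓ.
  rcases le_or_gt (1 / 3) δ with hδ3 | hδ3
  · exact le_trans (by linarith) measureReal_nonneg
  have hDp : IsProbabilityMeasure D := by
    rw [← hD 0]; exact Measure.isProbabilityMeasure_map (hγ 0).aemeasurable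
  have hα1 := hconc.le_one hL hC hα hmin hμ hx₀
  have hmax0 : 0 < μmax := hμ.trans_le (hmax.2 hmin.1)
  have hh : 0 < η * lam := by positivity
  have hT0 : (1 : ℝ) ≤ T := by exact_mod_cast hT
  obtain ⟨ℓ, hℓdef⟩ : ∃ ℓ, ℓ = Real.log (T / δ ^ 2) := ⟨_, rfl⟩
  have hexp : Real.exp ℓ = T / δ ^ 2 := by rw [hℓdef, Real.exp_log (by positivity)]
  have hδ9 : δ ^ 2 ≤ 1 / 9 := by nlinarith
  have hTℓ : 9 * (T : ℝ) ≤ Real.exp ℓ := by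
    rw [hexp, le_div_iff₀ (by positivity)]
    nlinarith
  have hℓ1 : 1 ≤ ℓ := by
    rw [← Real.exp_le_exp]
    linarith [Real.exp_one_lt_d9]
  have hδℓ : Real.exp (-ℓ) ≤ δ := by
    rw [Real.exp_neg, hexp, inv_div, div_le_iff₀ (by linarith)]
    nlinarith
  have hℓ0 : 0 < ℓ := by linarith
  have hsm : ℓ * (η * lam * C) ≤ α / 10 ^ 10 := by
    have h1 : η * lam ≤ 1 / 10 ^ 10 * (α / (C * ℓ)) := by
      rw [hℓdef]
      exact hsmall.trans (mul_le_mul_of_nonneg_left (min_le_right _ _) (by norm_num))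
    have h2 := mul_le_mul_of_nonneg_right h1 (show 0 ≤ C * ℓ by positivity)
    rw [mul_assoc (1 / 10 ^ 10 : ℝ), div_mul_cancel₀ _ (by positivity)] at h2
    linarith
  obtain ⟨s, hsdef⟩ : ∃ s, s = Real.sqrt (C / α * ℓ) * Real.sqrt (η * lam) := ⟨_, rfl⟩
  have hs0 : 0 < s := by rw [hsdef]; positivity
  have hss : s ^ 2 = C / α * ℓ * (η * lam) := by
    rw [hsdef, mul_pow, Real.sq_sqrt (by positivity), Real.sq_sqrt hh.le]
  have hsℓ : s ^ 2 * α = ℓ * (η * lam * C) := by rw [hss]; field_simp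
  -- The constant c = 10⁻¹⁰ gives s² = ℓhC/α ≤ 10⁻¹⁰, so the error 3000s is at most 0.03 and leaves
  -- room for the factor 2 bounds.
  have hs1 : s ≤ 1 / 100000 := by
    refine le_of_sq_le_sq ?_ (by norm_num)
    refine le_of_mul_le_mul_right (a := α) ?_ hα
    rw [hsℓ]
    norm_num at hsm ⊢
    linarith
  have herr : err = 3000 * s := by
    simp only [err]; rw [hsdef, hℓdef, mul_assoc]
  have hhC : η * lam * C ≤ α / 1000 := by
    have h1 : 1 * (η * lam * C) ≤ ℓ * (η * lam * C) :=
      mul_le_mul_of_nonneg_right hℓ1 (by positivity)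
    have h2 : α / 10 ^ 10 ≤ α / 1000 := by
      apply div_le_div_of_nonneg_left hα.le <;> norm_num
    linarith
  have hU := ClippedSGD.upper_tail hsi hdiff hL hγ hD hind hC hη hlam hT hx₀ hα hconc hmin hmax hμ
    hℓ1 hTℓ hδℓ hs0 hs1 hsℓ hhC (T' := T')
    (div_le_div_of_nonneg_right (add_le_add_left (le_max_left _ _) 4) (by positivity))
  have hLo := ClippedSGD.lower_tail hsi hdiff hL hγ hD hind hC hη hlam hT hx₀ hα hconc hmin hμ
    hℓ1 hTℓ hδℓ hs0 hs1 hsℓ hhC (T' := T')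
    (div_le_div_of_nonneg_right (add_le_add_left (le_max_right _ _) 4) (by positivity))
  set U := {ω | ∃ t : ℕ, T' ≤ (t : ℝ) ∧ t ≤ T ∧
      ClippedSGD.betaL η lam α ^ ((t : ℝ) - T') / 4 + 3000 * s <
        ClippedSGD.scaledNorm η lam
          (ClippedSGD.iterate C η lam x₀ (fun s => L (γ s ω)) t) ^ 2 / μmax - 1}
  set V := {ω | ∃ t : ℕ, T' ≤ (t : ℝ) ∧ t ≤ T ∧
      ClippedSGD.betaL η lam α ^ ((t : ℝ) - T') / 4 + 3000 * s <
        1 - ClippedSGD.scaledNorm η lam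
          (ClippedSGD.iterate C η lam x₀ (fun s => L (γ s ω)) t) ^ 2 / μmin}
  set G := {ω | ∀ t : ℕ, T' ≤ (t : ℝ) → t ≤ T →
          (μmin / 2 ≤ R t ω ^ 2 ∧ R t ω ^ 2 ≤ 2 * μmax) ∧
          ((1 - ClippedSGD.betaL η lam α ^ ((t : ℝ) - T')) * μmin - err * μmin ≤ R t ω ^ 2 ∧
            R t ω ^ 2 ≤
              μmax * (1 + ClippedSGD.betaU C η lam α ^ ((t : ℝ) - T')) + err * μmax)}
  -- Covering the space avoids any measurability question for `G`: subadditivity bounds P(G) from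
  -- below by 1 - 2δ.
  have hcover : Set.univ ⊆ G ∪ (U ∪ V) := by
    intro ω _
    by_cases hωU : ω ∈ U
    · exact Or.inr (Or.inl hωU)
    by_cases hωV : ω ∈ V
    · exact Or.inr (Or.inr hωV)
    refine Or.inl fun t ht htT => ?_
    have h1 : R t ω ^ 2 / μmax - 1 ≤
        ClippedSGD.betaL η lam α ^ ((t : ℝ) - T') / 4 + 3000 * s := by
      by_contra hlt
      exact hωU ⟨t, ht, htT, not_le.1 hlt⟩
    have h2 : 1 - R t ω ^ 2 / μmin ≤
        ClippedSGD.betaL η lam α ^ ((t : ℝ) - T') / 4 + 3000 * s := by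
      by_contra hlt
      exact hωV ⟨t, ht, htT, not_le.1 hlt⟩
    have hhα : η * lam ≤ 1 / 1000 := by nlinarith
    obtain ⟨hβ0, hβ1, -⟩ := ClippedSGD.le_exp_neg_of_betaL (β := ClippedSGD.betaL η lam α) hh hα hα1
      hhα (by unfold ClippedSGD.betaL; ring)
    have hβ1' : ClippedSGD.betaL η lam α ≤ 1 := by
      have : 0 ≤ 2 * (η * lam) * α := by positivity
      linarith
    have hpow1 : ClippedSGD.betaL η lam α ^ ((t : ℝ) - T') ≤ 1 :=
      Real.rpow_le_one hβ0.le hβ1' (by linarith)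
    have hpow0 : 0 ≤ ClippedSGD.betaL η lam α ^ ((t : ℝ) - T') := Real.rpow_nonneg hβ0.le _
    have hpowU : ClippedSGD.betaL η lam α ^ ((t : ℝ) - T') ≤
        ClippedSGD.betaU C η lam α ^ ((t : ℝ) - T') := by
      refine Real.rpow_le_rpow hβ0.le ?_ (by linarith)
      unfold ClippedSGD.betaL ClippedSGD.betaU
      have : 0 ≤ 4 * C ^ 2 * η ^ 2 * lam ^ 2 := by positivity
      linarith
    set B := ClippedSGD.betaL η lam α ^ ((t : ℝ) - T')
    have h1' : R t ω ^ 2 ≤ (1 + B / 4 + 3000 * s) * μmax := by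
      rw [← div_le_iff₀ hmax0]; linarith
    have h2' : (1 - B / 4 - 3000 * s) * μmin ≤ R t ω ^ 2 := by
      rw [← le_div_iff₀ hμ]; linarith
    rw [herr]
    refine ⟨⟨le_trans ?_ h2', h1'.trans ?_⟩, le_trans ?_ h2', h1'.trans ?_⟩
    · have := mul_le_mul_of_nonneg_right (show 1 / 2 ≤ 1 - B / 4 - 3000 * s by linarith) hμ.le
      linarith
    · exact mul_le_mul_of_nonneg_right (by linarith) hmax0.le
    · have := mul_le_mul_of_nonneg_right
        (show 1 - B - 3000 * s ≤ 1 - B / 4 - 3000 * s by linarith) hμ.le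
      linarith
    · have := mul_le_mul_of_nonneg_right
        (show 1 + B / 4 + 3000 * s ≤
          1 + ClippedSGD.betaU C η lam α ^ ((t : ℝ) - T') + 3000 * s by linarith) hmax0.le
      linarith
  have hone : (1 : ℝ) ≤ P.real G + (P.real U + P.real V) := by
    calc (1 : ℝ) = P.real Set.univ := probReal_univ.symm
      _ ≤ P.real (G ∪ (U ∪ V)) := measureReal_mono hcover
      _ ≤ _ := (measureReal_union_le _ _).trans (by gcongr; exact measureReal_union_le _ _)
  linarith
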